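/- Let $P$ be the transition matrix of a time-homogeneous Markov chain in discrete time on a finite state space $S$, and let $P^n(x,\cdot)$ denote the distribution at time $n$ of the chain started in $x\in S$. For probability distributions $\mu,\nu$ on $S$ let $\lVert\mu-\nu\rVert_{\mathrm{TV}}=\sup_{A\subseteq S}|\mu(A)-\nu(A)|$. Two copies of the chain started in $x$ and $y$ can be coupled to meet almost surely if there are processes $(X_n)_{n\ge 0}$ and $(Y_n)_{n\ge 0}$ on a common probability space such that each of them, by itself, is a Markov chain with transition matrix $P$, $X_0=x$ and $Y_0=y$ almost surely, and $\mathbb{P}(X_n=Y_n\text{ for some }n\ge 0)=1$ (no further condition, such as the Markov property of the pair, is imposed on the joint law). The chain is said to segregate $x$ and $y$ if, in addition, $\lim_{n\to\infty}\lVert P^n(x,\cdot)-P^n(y,\cdot)\rVert_{\mathrm{TV}}>0$. **Theorem.** The limit $\lim_{n\to\infty}\lVert P^n(x,\cdot)-P^n(y,\cdot)\rVert_{\mathrm{TV}}$ exists for every finite Markov chain and all states $x,y$. Let $$\kappa:=\sup\lim_{n\to\infty}\lVert P^n(x,\cdot)-P^n(y,\cdot)\rVert_{\mathrm{TV}},$$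 where the supremum is taken over all finite Markov chain transition matrices $P$ and all states $x,y$ such that two copies of the chain, started in $x$ and in $y$, can be coupled to meet almost surely. Then $\kappa=\tfrac12$. The supremum is also $\tfrac12$ if it is taken only over the finite chains $P$ and states $x,y$ such that $P$ segregates $x$ and $y$. -/

import Mathlib

open Filter Topology MeasureTheory

/-- Total variation distance `sup_{A ⊆ S} |p(A) - q(A)|` of two distributions on a finite set,
given by their probability mass functions. -/
noncomputable def tvDist {S : Type} (p q : S → ℝ) : ℝ :=
  ⨆ A : Finset S, |∑ s ∈ A, p s - ∑ s ∈ A, q s|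

/-- `X` is a (time-homogeneous) Markov chain with transition probabilities `P`, started in `x`:
every `X n` is a random variable, `X 0 = x` almost surely, and, given any past `s 0, …, s n`, the
next state is `s (n + 1)` with conditional probability `P (s n) (s (n + 1))`. -/
structure IsMarkovChainFrom {S Ω : Type} [MeasurableSpace Ω] (P : Matrix S S ℝ) (x : S)
    (μ : Measure Ω) (X : ℕ → Ω → S) : Prop where
  measurableSet_eq : ∀ (n : ℕ) (s : S), MeasurableSet {ω | X n ω = s}
  start : ∀ᵐ ω ∂μ, X 0 ω = x
  step : ∀ (n : ℕ) (s : ℕ → S),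
    μ.real {ω | ∀ i ≤ n + 1, X i ω = s i} =
      μ.real {ω | ∀ i ≤ n, X i ω = s i} * P (s n) (s (n + 1))

/-- Two copies of the chain with transition matrix `P`, one started in `x` and the other in `y`,
can be coupled (defined on one probability space, with an arbitrary joint law) so that almost
surely they are in the same state at some finite time. -/
def CanBeCoupledToMeet {S : Type} (P : Matrix S S ℝ) (x y : S) : Prop :=
  ∃ (Ω : Type) (_ : MeasurableSpace Ω) (μ : Measure Ω) (X Y : ℕ → Ω → S),
    IsProbabilityMeasure μ ∧ IsMarkovChainFrom P x μ X ∧ IsMarkovChainFrom P y μ Y ∧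
      ∀ᵐ ω ∂μ, ∃ n : ℕ, X n ω = Y n ω

/-- `lim_{n → ∞} ‖P^n(x, ·) - P^n(y, ·)‖_TV` exists and equals `l`. -/
def HasTVLimit {S : Type} [Fintype S] [DecidableEq S] (P : Matrix S S ℝ) (x y : S) (l : ℝ) :
    Prop :=
  Tendsto (fun n : ℕ => tvDist ((P ^ n) x) ((P ^ n) y)) atTop (𝓝 l)

/-- The chain with transition matrix `P` segregates `x` and `y`: two copies can be coupled to meet
almost surely, while the distance of their distributions has a positive limit. -/
def Segregates {S : Type} [Fintype S] [DecidableEq S] (P : Matrix S S ℝ) (x y : S) : Prop :=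
  CanBeCoupledToMeet P x y ∧ ∃ l : ℝ, 0 < l ∧ HasTVLimit P x y l

/-- The limits of the total variation distance, over all finite Markov chains and pairs of states
that can be coupled to meet almost surely. -/
def meetingLimits : Set ℝ :=
  {l | ∃ (S : Type) (_ : Fintype S) (_ : DecidableEq S) (P : Matrix S S ℝ) (x y : S),
    P ∈ Matrix.rowStochastic ℝ S ∧ CanBeCoupledToMeet P x y ∧ HasTVLimit P x y l}

/-- The limits of the total variation distance, over all finite Markov chains and pairs of states
that they segregate. -/
def segregationLimits : Set ℝ :=
  {l | ∃ (S : Type) (_ : Fintype S) (_ : DecidableEq S) (P : Matrix S S ℝ) (x y : S),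
    P ∈ Matrix.rowStochastic ℝ S ∧ Segregates P x y ∧ HasTVLimit P x y l}

/-- The constant `κ`. -/
noncomputable def kappa : ℝ := sSup meetingLimits

/-!
Existence of the limit: a stochastic matrix contracts the total variation distance, so the distances
decrease (`tvDist_pow_antitone`).

Upper bound. Fix a time `n` and a set `A` of states. Along either copy of the chain the probability
`P ^ (n - k) (X k, A)` of ending in `A` is a martingale in `k ≤ n`, and so is the complementary
probability. At a meeting point one of the two is at least `1 / 2`. Doob's maximal inequality
(`IsMarkovChainFrom.maximal_inequality`) bounds the probability that the copy started in `y` ever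
sees the first one exceed `1 / 2` by `2 * P ^ n (y, A)`, and the probability that the copy started
in `x` ever sees the second one exceed `1 / 2` by `2 * P ^ n (x, Aᶜ)`. Hence the probability of a
meeting by time `n` is at most `2 * (1 - P ^ n (x, A) + P ^ n (y, A))`, which is
`tvDist_le_of_meet`. Only the marginal laws of the coupling enter.

Lower bound. Simple random walk on `[-H, H]`, absorbed at the ends and started from `z` and `-z`
with `z` slightly below `H / 2`, has total variation limit `z / H`. The two untimed paths can be
coupled to visit a common point (`exists_path_coupling`): after reflecting the second walk, the
minima of the two paths must have a nonpositive sum, and gambler's ruin together with Hall's theorem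
gives such a matching. To turn a common point into a meeting, the walk is started after a uniform
delay `g < L`, so that the difference of the two times of visit is undone by a cyclic shift of the
delay. The shift wraps around the end of `[0, L)` only if both delays are extreme; to have the two
copies meet in that case too, a walk that is absorbed very early or very late is sent to one common
state, at a cost that vanishes as `L` grows. This requires that a path is absorbed within a bounded
time `m` of its start whenever a shift is used. The paths that survive longer are therefore coupled
without any shift: a surviving path that has not crossed the origin is matched with one ending at
the opposite point. There are enough of the latter if `m` is large, because the ratio of the
probabilities of surviving with and without a crossing grows with time
(`exists_posProb_le_aliveProb`).

The chain is realised by finitely many uniform random variables, so that a coupling is a bijection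
of a finite set (`exists_chain_of_noiseTraj_meet`); time is part of the state.
-/

/-! ### Total variation distance -/

section TotalVariation

lemma tvDist_comm {S : Type} (p q : S → ℝ) : tvDist p q = tvDist q p := by
  simp only [tvDist, abs_sub_comm]

variable {S : Type} [Fintype S]

lemma abs_sum_sub_sum_le_tvDist (p q : S → ℝ) (A : Finset S) :
    |∑ s ∈ A, p s - ∑ s ∈ A, q s| ≤ tvDist p q :=
  le_ciSup (f := fun A : Finset S => |∑ s ∈ A, p s - ∑ s ∈ A, q s|) (Set.finite_range _).bddAbove A

lemma tvDist_nonneg (p q : S → ℝ) : 0 ≤ tvDist p q :=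
  (abs_nonneg _).trans (abs_sum_sub_sum_le_tvDist p q ∅)

/-- The expectations of a `[0, 1]`-valued function differ by at most the total variation
distance. -/
lemma sum_mul_le_tvDist (p q c : S → ℝ) (h0 : ∀ s, 0 ≤ c s) (h1 : ∀ s, c s ≤ 1) :
    ∑ s, (p s - q s) * c s ≤ tvDist p q := by
  classical
  calc ∑ s, (p s - q s) * c s
      ≤ ∑ s, if 0 ≤ p s - q s then p s - q s else 0 := by
        refine Finset.sum_le_sum fun s _ => ?_
        split_ifs with h
        · exact mul_le_of_le_one_right h (h1 s)
        · exact mul_nonpos_of_nonpos_of_nonneg (le_of_not_ge h) (h0 s)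
    _ = ∑ s ∈ Finset.univ.filter (fun s => 0 ≤ p s - q s), p s
          - ∑ s ∈ Finset.univ.filter (fun s => 0 ≤ p s - q s), q s := by
        rw [← Finset.sum_sub_distrib, Finset.sum_filter]
    _ ≤ tvDist p q := (le_abs_self _).trans (abs_sum_sub_sum_le_tvDist p q _)

variable [DecidableEq S]

lemma sum_row_pow_succ (P : Matrix S S ℝ) (x : S) (n : ℕ) (A : Finset S) :
    ∑ s ∈ A, (P ^ (n + 1)) x s = ∑ t, (P ^ n) x t * ∑ s ∈ A, P t s := by
  simp only [pow_succ, Matrix.mul_apply, Finset.mul_sum]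
  exact Finset.sum_comm

lemma sum_finset_row_le_one {P : Matrix S S ℝ} (hP : P ∈ Matrix.rowStochastic ℝ S) (t : S)
    (A : Finset S) : ∑ s ∈ A, P t s ≤ 1 := by
  rw [← Matrix.sum_row_of_mem_rowStochastic hP t]
  exact Finset.sum_le_sum_of_subset_of_nonneg (Finset.subset_univ A)
    fun s _ _ => Matrix.nonneg_of_mem_rowStochastic hP

/-- A stochastic matrix contracts the total variation distance. -/
lemma tvDist_pow_antitone {P : Matrix S S ℝ} (hP : P ∈ Matrix.rowStochastic ℝ S) (x y : S) :
    Antitone fun n : ℕ => tvDist ((P ^ n) x) ((P ^ n) y) := by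
  refine antitone_nat_of_succ_le fun n => ciSup_le fun A => ?_
  have key : ∀ x y : S, ∑ s ∈ A, (P ^ (n + 1)) x s - ∑ s ∈ A, (P ^ (n + 1)) y s
      ≤ tvDist ((P ^ n) x) ((P ^ n) y) := fun x y => by
    rw [sum_row_pow_succ, sum_row_pow_succ, ← Finset.sum_sub_distrib]
    simp only [← sub_mul]
    exact sum_mul_le_tvDist _ _ _
      (fun t => Finset.sum_nonneg fun s _ => Matrix.nonneg_of_mem_rowStochastic hP)
      (fun t => sum_finset_row_le_one hP t A)
  rw [abs_le]
  constructor
  · have := key y x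
    rw [tvDist_comm] at this
    linarith
  · exact key x y

lemma exists_hasTVLimit {P : Matrix S S ℝ} (hP : P ∈ Matrix.rowStochastic ℝ S) (x y : S) :
    ∃ l, HasTVLimit P x y l :=
  ⟨_, tendsto_atTop_ciInf (tvDist_pow_antitone hP x y)
    ⟨0, by rintro _ ⟨n, rfl⟩; exact tvDist_nonneg _ _⟩⟩

end TotalVariation

/-! ### Markov chains along a fixed sequence of sets -/

section MarkovChain

variable {S Ω : Type} [Fintype S] [DecidableEq S] [MeasurableSpace Ω] {P : Matrix S S ℝ} {x : S}
  {μ : Measure Ω} {X : ℕ → Ω → S}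

omit [DecidableEq S] in
lemma IsMarkovChainFrom.measurableSet_pred (h : IsMarkovChainFrom P x μ X) (k : ℕ)
    (E : S → Prop) : MeasurableSet {ω | E (X k ω)} := by
  have : {ω | E (X k ω)} = ⋃ s ∈ {s | E s}, {ω | X k ω = s} := by ext; simp
  rw [this]
  exact MeasurableSet.biUnion (Set.to_countable _) fun s _ => h.measurableSet_eq k s

omit [DecidableEq S] in
lemma IsMarkovChainFrom.measurableSet_stay (h : IsMarkovChainFrom P x μ X) (k : ℕ)
    (B : ℕ → Set S) : MeasurableSet {ω | ∀ i < k, X i ω ∈ B i} := by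
  have : {ω | ∀ i < k, X i ω ∈ B i} = ⋂ i ∈ {i | i < k}, {ω | X i ω ∈ B i} := by ext; simp
  rw [this]
  exact MeasurableSet.biInter (Set.to_countable _) fun i _ => h.measurableSet_pred i _

omit [DecidableEq S] in
/-- An event that depends on the first `k + 1` states only is a disjoint union of cylinders. -/
lemma IsMarkovChainFrom.measureReal_eq_sum_cylinder (h : IsMarkovChainFrom P x μ X)
    [IsFiniteMeasure μ] (k : ℕ) (E : (Fin (k + 1) → S) → Prop) [DecidablePred E] (F : Set Ω)
    (hF : MeasurableSet F) :
    μ.real ({ω | E fun i => X i ω} ∩ F) =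
      ∑ s with E s, μ.real ({ω | ∀ i : Fin (k + 1), X i ω = s i} ∩ F) := by
  have hd : {ω | E fun i => X i ω} ∩ F =
      ⋃ s ∈ Finset.univ.filter E, ({ω | ∀ i : Fin (k + 1), X i ω = s i} ∩ F) := by
    ext ω
    simp only [Set.mem_inter_iff, Set.mem_ofPred_eq, Finset.mem_filter, Finset.mem_univ, true_and,
      Set.mem_iUnion, exists_prop]
    constructor
    · rintro ⟨h1, h2⟩
      exact ⟨_, h1, fun i => rfl, h2⟩
    · rintro ⟨s, h1, h2, h3⟩
      have : (fun i : Fin (k + 1) => X i ω) = s := funext h2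
      exact ⟨this ▸ h1, h3⟩
  rw [hd, measureReal_biUnion_finset]
  · intro s _ t _ hst
    refine Set.disjoint_left.2 fun ω h1 h2 => hst ?_
    funext i
    exact (h1.1 i).symm.trans (h2.1 i)
  · intro s _
    refine MeasurableSet.inter ?_ hF
    have : {ω | ∀ i : Fin (k + 1), X i ω = s i} = ⋂ i : Fin (k + 1), {ω | X i ω = s i} := by
      ext; simp
    rw [this]
    exact MeasurableSet.iInter fun i => h.measurableSet_eq i _

/-- The Markov property for events of the past. -/
lemma IsMarkovChainFrom.measureReal_step (h : IsMarkovChainFrom P x μ X)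
    [IsFiniteMeasure μ] (k : ℕ) (E : (Fin (k + 1) → S) → Prop) (z w : S) :
    μ.real ({ω | E fun i => X i ω} ∩ {ω | X k ω = z} ∩ {ω | X (k + 1) ω = w}) =
      μ.real ({ω | E fun i => X i ω} ∩ {ω | X k ω = z}) * P z w := by
  classical
  have e : {ω | E fun i => X i ω} ∩ {ω | X k ω = z} =
      {ω | (fun s : Fin (k + 1) → S => E s ∧ s (Fin.last k) = z) fun i => X i ω} ∩ Set.univ := by
    ext; simp
  have e' : {ω | E fun i => X i ω} ∩ {ω | X k ω = z} ∩ {ω | X (k + 1) ω = w} =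
      {ω | (fun s : Fin (k + 1) → S => E s ∧ s (Fin.last k) = z) fun i => X i ω}
        ∩ {ω | X (k + 1) ω = w} := by
    ext; simp
  have a := h.measureReal_eq_sum_cylinder k (fun s => E s ∧ s (Fin.last k) = z) _
    (h.measurableSet_eq (k + 1) w)
  have b := h.measureReal_eq_sum_cylinder k (fun s => E s ∧ s (Fin.last k) = z) _
    MeasurableSet.univ
  rw [e', e]
  refine a.trans (Eq.trans ?_ (congrArg (· * P z w) b).symm)
  rw [Finset.sum_mul]
  refine Finset.sum_congr rfl fun s hs => ?_
  obtain ⟨-, -, hz⟩ := Finset.mem_filter.1 hs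
  have := h.step k (fun i => if hi : i < k + 1 then s ⟨i, hi⟩ else w)
  simp only [lt_add_iff_pos_right, zero_lt_one, dite_true, lt_irrefl, dite_false] at this
  rw [← hz]
  convert this using 2
  · ext ω
    simp only [Set.mem_inter_iff, Set.mem_ofPred_eq]
    constructor
    · rintro ⟨h1, h2⟩ i hi
      split_ifs with hi'
      · exact h1 ⟨i, hi'⟩
      · obtain rfl : i = k + 1 := by omega
        exact h2
    · intro h1
      refine ⟨fun i => ?_, ?_⟩
      · have := h1 i (by omega)
        rwa [dif_pos i.2] at this
      · simpa using h1 (k + 1) le_rfl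
  · congr 1
    ext ω
    simp only [Set.inter_univ, Set.mem_ofPred_eq]
    constructor
    · intro h1 i hi
      rw [dif_pos (by omega)]
      exact h1 ⟨i, by omega⟩
    · intro h1 i
      have := h1 i (by omega)
      rwa [dif_pos i.2] at this
  · rfl

/-- The mass at `z` at time `k` of the chain killed when it first leaves the sets `B i`. -/
def stayMass (μ : Measure Ω) (X : ℕ → Ω → S) (B : ℕ → Set S) (k : ℕ) (z : S) : ℝ :=
  μ.real ({ω | ∀ i < k, X i ω ∈ B i} ∩ {ω | X k ω = z})

omit [Fintype S] [DecidableEq S] in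
lemma stayMass_nonneg (B : ℕ → Set S) (k : ℕ) (z : S) : 0 ≤ stayMass μ X B k z :=
  measureReal_nonneg

omit [Fintype S] in
lemma IsMarkovChainFrom.stayMass_zero (h : IsMarkovChainFrom P x μ X) [IsProbabilityMeasure μ]
    (B : ℕ → Set S) (z : S) : stayMass μ X B 0 z = if z = x then 1 else 0 := by
  simp only [stayMass, not_lt_zero, IsEmpty.forall_iff, implies_true, Set.ofPred_true,
    Set.univ_inter]
  split_ifs with hz
  · subst hz
    have : {ω | X 0 ω = z} =ᵐ[μ] Set.univ := by
      filter_upwards [h.start] with ω hω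
      exact propext ⟨fun _ => trivial, fun _ => hω⟩
    rw [measureReal_congr this, probReal_univ]
  · have : {ω | X 0 ω = z} =ᵐ[μ] (∅ : Set Ω) := by
      filter_upwards [h.start] with ω hω
      refine propext ⟨fun h' => hz ?_, fun h' => h'.elim⟩
      exact (h' : X 0 ω = z).symm.trans hω
    rw [measureReal_congr this, measureReal_empty]

open Classical in
lemma IsMarkovChainFrom.stayMass_succ (h : IsMarkovChainFrom P x μ X) [IsFiniteMeasure μ]
    (B : ℕ → Set S) (k : ℕ) (w : S) :
    stayMass μ X B (k + 1) w = ∑ z with z ∈ B k, stayMass μ X B k z * P z w := by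
  have hd : {ω | ∀ i < k + 1, X i ω ∈ B i} ∩ {ω | X (k + 1) ω = w} =
      ⋃ z ∈ Finset.univ.filter (· ∈ B k), ({ω | ∀ i < k, X i ω ∈ B i} ∩ {ω | X k ω = z} ∩
        {ω | X (k + 1) ω = w}) := by
    ext ω
    simp only [Set.mem_inter_iff, Set.mem_ofPred_eq, Finset.mem_filter, Finset.mem_univ, true_and,
      Set.mem_iUnion, exists_prop]
    constructor
    · rintro ⟨h1, h2⟩
      exact ⟨_, h1 k (by omega), ⟨fun i hi => h1 i (by omega), rfl⟩, h2⟩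
    · rintro ⟨s, h1, ⟨h2, rfl⟩, h3⟩
      refine ⟨fun i hi => ?_, h3⟩
      rcases Nat.lt_succ_iff_lt_or_eq.1 hi with hi | rfl
      · exact h2 i hi
      · exact h1
  rw [stayMass, hd, measureReal_biUnion_finset]
  · refine Finset.sum_congr rfl fun z _ => ?_
    have := h.measureReal_step k (fun s => ∀ i : Fin (k + 1), (i : ℕ) < k → s i ∈ B i) z w
    have e : {ω | ∀ i : Fin (k + 1), (i : ℕ) < k → X i ω ∈ B i} = {ω | ∀ i < k, X i ω ∈ B i} := by
      ext ω
      exact ⟨fun h i hi => h ⟨i, by omega⟩ hi, fun h i hi => h i hi⟩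
    rw [e] at this
    exact this
  · intro s _ t _ hst
    exact Set.disjoint_left.2 fun ω h1 h2 => hst (h1.1.2.symm.trans h2.1.2)
  · intro z _
    exact ((h.measurableSet_stay k B).inter (h.measurableSet_eq _ _)).inter (h.measurableSet_eq _ _)

lemma IsMarkovChainFrom.measureReal_eq_pow (h : IsMarkovChainFrom P x μ X)
    [IsProbabilityMeasure μ] (n : ℕ) (z : S) : μ.real {ω | X n ω = z} = (P ^ n) x z := by
  have key : ∀ n z, stayMass μ X (fun _ => Set.univ) n z = (P ^ n) x z := by
    intro n
    induction n with
    | zero =>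
      intro z
      rw [h.stayMass_zero, pow_zero, Matrix.one_apply]
      simp only [eq_comm]
    | succ n ih =>
      intro z
      rw [h.stayMass_succ, pow_succ, Matrix.mul_apply]
      simp [ih]
  rw [← key]
  simp [stayMass]

omit [DecidableEq S] in
lemma IsMarkovChainFrom.sum_stayMass (h : IsMarkovChainFrom P x μ X) [IsFiniteMeasure μ]
    (B : ℕ → Set S) (k : ℕ) (A : Finset S) :
    ∑ z ∈ A, stayMass μ X B k z = μ.real {ω | (∀ i < k, X i ω ∈ B i) ∧ X k ω ∈ A} := by
  have hd : {ω | (∀ i < k, X i ω ∈ B i) ∧ X k ω ∈ A} =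
      ⋃ z ∈ A, ({ω | ∀ i < k, X i ω ∈ B i} ∩ {ω | X k ω = z}) := by
    ext ω; simp
  rw [hd, measureReal_biUnion_finset]
  · rfl
  · intro s _ t _ hst
    exact Set.disjoint_left.2 fun ω h1 h2 => hst (h1.2.symm.trans h2.2)
  · intro z _
    exact (h.measurableSet_stay k B).inter (h.measurableSet_eq _ _)

/-- Doob's maximal inequality for the martingale `P ^ (n - k) (X k, A)`, `k ≤ n`. -/
lemma IsMarkovChainFrom.maximal_inequality (h : IsMarkovChainFrom P x μ X)
    [IsProbabilityMeasure μ] (hP : P ∈ Matrix.rowStochastic ℝ S) (n : ℕ) (A : Finset S) (c : ℝ) :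
    c * μ.real {ω | ∃ k ≤ n, c ≤ ∑ s ∈ A, (P ^ (n - k)) (X k ω) s} ≤ ∑ s ∈ A, (P ^ n) x s := by
  classical
  set g : ℕ → S → ℝ := fun k z => ∑ s ∈ A, (P ^ (n - k)) z s with hg
  have hg0 : ∀ k z, 0 ≤ g k z := fun k z => Finset.sum_nonneg fun s _ =>
    Matrix.nonneg_of_mem_rowStochastic (pow_mem hP _)
  set B : ℕ → Set S := fun k => {z | g k z < c} with hB
  set m := stayMass μ X B with hm
  -- `g k (X k)` is a martingale
  have hstep : ∀ k < n, ∀ z, ∑ w, P z w * g (k + 1) w = g k z := by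
    intro k hk z
    simp only [hg]
    have : n - k = (n - (k + 1)) + 1 := by omega
    rw [this]
    simp only [pow_succ', Matrix.mul_apply, Finset.mul_sum]
    exact Finset.sum_comm
  -- the chain is killed where `g k ≥ c`; replacing `g k` by `c` there can only lose mass
  have key : ∀ k ≤ n, ∑ z, m k z * g k z + c * (1 - ∑ z, m k z) ≤ g 0 x := by
    intro k
    induction k with
    | zero =>
      intro _
      simp [hm, h.stayMass_zero]
    | succ k ih =>
      intro hk
      have h1 : ∑ w, m (k + 1) w * g (k + 1) w = ∑ z with z ∈ B k, m k z * g k z := by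
        simp only [hm, h.stayMass_succ, Finset.sum_mul]
        rw [Finset.sum_comm]
        refine Finset.sum_congr rfl fun z _ => ?_
        rw [← hstep k hk, Finset.mul_sum]
        simp only [mul_assoc]
      have h2 : ∑ w, m (k + 1) w = ∑ z with z ∈ B k, m k z := by
        simp only [hm, h.stayMass_succ]
        rw [Finset.sum_comm]
        refine Finset.sum_congr rfl fun z _ => ?_
        rw [← Finset.mul_sum, Matrix.sum_row_of_mem_rowStochastic hP, mul_one]
      refine le_trans ?_ (ih (by omega))
      rw [h1, h2, ← Finset.sum_filter_add_sum_filter_not Finset.univ (· ∈ B k) (m k),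
        ← Finset.sum_filter_add_sum_filter_not Finset.univ (· ∈ B k) (fun z => m k z * g k z)]
      have h3 : c * ∑ z with z ∉ B k, m k z ≤ ∑ z with z ∉ B k, m k z * g k z := by
        rw [Finset.mul_sum]
        refine Finset.sum_le_sum fun z hz => ?_
        have hz' : c ≤ g k z := by simpa [hB] using hz
        rw [mul_comm]
        exact mul_le_mul_of_nonneg_left hz' (stayMass_nonneg B k z)
      linarith
  have hn := key n le_rfl
  have hcompl : {ω | ∃ k ≤ n, c ≤ g k (X k ω)} =
      {ω | (∀ i < n, X i ω ∈ B i) ∧ X n ω ∈ Finset.univ.filter (· ∈ B n)}ᶜ := by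
    ext ω
    simp only [Set.mem_ofPred_eq, Set.mem_compl_iff, hB, Finset.mem_filter, Finset.mem_univ,
      true_and, not_and_or, not_forall, not_lt, exists_prop]
    constructor
    · rintro ⟨k, hk, hc⟩
      rcases hk.lt_or_eq with hk | rfl
      · exact Or.inl ⟨k, hk, hc⟩
      · exact Or.inr hc
    · rintro (⟨k, hk, hc⟩ | hc)
      · exact ⟨k, hk.le, hc⟩
      · exact ⟨n, le_rfl, hc⟩
  have hmeas : MeasurableSet {ω | (∀ i < n, X i ω ∈ B i) ∧
      X n ω ∈ Finset.univ.filter (· ∈ B n)} :=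
    (h.measurableSet_stay n B).inter (h.measurableSet_pred n _)
  rw [hcompl, probReal_compl_eq_one_sub hmeas, ← h.sum_stayMass]
  rw [← Finset.sum_filter_add_sum_filter_not Finset.univ (· ∈ B n) (m n),
    ← Finset.sum_filter_add_sum_filter_not Finset.univ (· ∈ B n) (fun z => m n z * g n z)] at hn
  have h3 : c * ∑ z with z ∉ B n, m n z ≤ ∑ z with z ∉ B n, m n z * g n z := by
    rw [Finset.mul_sum]
    refine Finset.sum_le_sum fun z hz => ?_
    have hz' : c ≤ g n z := by simpa [hB] using hz
    rw [mul_comm]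
    exact mul_le_mul_of_nonneg_left hz' (stayMass_nonneg B n z)
  have h4 : 0 ≤ ∑ z with z ∈ B n, m n z * g n z :=
    Finset.sum_nonneg fun z _ => mul_nonneg (stayMass_nonneg B n z) (hg0 n z)
  have h5 : g 0 x = ∑ s ∈ A, (P ^ n) x s := by simp [hg]
  rw [← h5]
  linarith

end MarkovChain

/-! ### The upper bound -/

section UpperBound

variable {S Ω : Type} [Fintype S] [DecidableEq S] [MeasurableSpace Ω] {P : Matrix S S ℝ} {x y : S}
  {μ : Measure Ω} {X Y : ℕ → Ω → S}

/-- At a meeting point `z` at time `k ≤ n` either `P ^ (n - k) (z, A)` or its complementary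
probability is at least `1 / 2`, so that one of two maximal inequalities applies. -/
lemma tvDist_le_of_meet (hP : P ∈ Matrix.rowStochastic ℝ S) [IsProbabilityMeasure μ]
    (hX : IsMarkovChainFrom P x μ X) (hY : IsMarkovChainFrom P y μ Y) (n : ℕ) :
    tvDist ((P ^ n) x) ((P ^ n) y) ≤ 1 - μ.real {ω | ∃ k ≤ n, X k ω = Y k ω} / 2 := by
  have hsum : ∀ k (z : S) (A : Finset S),
      ∑ s ∈ A, (P ^ k) z s + ∑ s ∈ Aᶜ, (P ^ k) z s = 1 := fun k z A => by
    rw [Finset.sum_add_sum_compl, Matrix.sum_row_of_mem_rowStochastic (pow_mem hP k)]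
  have key : ∀ A : Finset S, ∑ s ∈ A, (P ^ n) x s - ∑ s ∈ A, (P ^ n) y s
      ≤ 1 - μ.real {ω | ∃ k ≤ n, X k ω = Y k ω} / 2 := by
    intro A
    have h1 := hX.maximal_inequality hP n Aᶜ (1 / 2)
    have h2 := hY.maximal_inequality hP n A (1 / 2)
    have h3 : μ.real {ω | ∃ k ≤ n, X k ω = Y k ω} ≤
        μ.real {ω | ∃ k ≤ n, 1 / 2 ≤ ∑ s ∈ Aᶜ, (P ^ (n - k)) (X k ω) s} +
        μ.real {ω | ∃ k ≤ n, 1 / 2 ≤ ∑ s ∈ A, (P ^ (n - k)) (Y k ω) s} := by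
      refine le_trans (measureReal_mono ?_) (measureReal_union_le _ _)
      rintro ω ⟨k, hk, he⟩
      have h := hsum (n - k) (Y k ω) A
      by_cases hc : 1 / 2 ≤ ∑ s ∈ A, (P ^ (n - k)) (Y k ω) s
      · exact Or.inr ⟨k, hk, hc⟩
      · refine Or.inl ⟨k, hk, ?_⟩
        rw [he]
        linarith
    have h4 := hsum n x A
    linarith
  refine ciSup_le fun A => ?_
  rw [abs_le]
  refine ⟨?_, key A⟩
  have := key Aᶜ
  have h4 := hsum n x A
  have h5 := hsum n y A
  linarith

lemma tvLimit_le_half_of_meet (hP : P ∈ Matrix.rowStochastic ℝ S) (hc : CanBeCoupledToMeet P x y)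
    {l : ℝ} (hl : HasTVLimit P x y l) : l ≤ 1 / 2 := by
  obtain ⟨Ω, mΩ, μ, X, Y, hμ, hX, hY, hm⟩ := hc
  have h1 : Tendsto (fun n => μ.real {ω | ∃ k ≤ n, X k ω = Y k ω}) atTop (𝓝 1) := by
    have hmono : Monotone fun n => {ω | ∃ k ≤ n, X k ω = Y k ω} :=
      fun a b hab ω ⟨k, hk, he⟩ => ⟨k, hk.trans hab, he⟩
    have h := tendsto_measure_iUnion_atTop (μ := μ) hmono
    have hu : (⋃ n, {ω | ∃ k ≤ n, X k ω = Y k ω}) =ᵐ[μ] Set.univ := by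
      filter_upwards [hm] with ω ⟨k, hk⟩
      refine propext ⟨fun _ => trivial, fun _ => ?_⟩
      exact Set.mem_iUnion.2 ⟨k, k, le_rfl, hk⟩
    rw [measure_congr hu, measure_univ] at h
    have := (ENNReal.tendsto_toReal ENNReal.one_ne_top).comp h
    simpa [Measure.real, Function.comp_def] using this
  have h2 := (tendsto_const_nhds (x := (1 : ℝ))).sub (h1.div_const 2)
  have := le_of_tendsto_of_tendsto' hl h2 fun n => tvDist_le_of_meet hP hX hY n
  linarith

end UpperBound

/-! ### Uniform probability on a finite type -/

section UniformProbability

variable {Ω Ω' : Type}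

/-- The probability of the event `p` under the uniform distribution on `Ω`. -/
noncomputable def uprob (p : Ω → Prop) : ℝ := (Nat.card {ω // p ω} : ℝ) / Nat.card Ω

lemma uprob_nonneg (p : Ω → Prop) : 0 ≤ uprob p := by unfold uprob; positivity

lemma uprob_congr {p q : Ω → Prop} (h : ∀ ω, p ω ↔ q ω) : uprob p = uprob q := by
  rw [funext fun ω => propext (h ω)]

lemma uprob_mono [Finite Ω] {p q : Ω → Prop} (h : ∀ ω, p ω → q ω) : uprob p ≤ uprob q := by
  unfold uprob
  have : Nat.card {ω // p ω} ≤ Nat.card {ω // q ω} :=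
    Nat.card_le_card_of_injective (Subtype.map id h) (Subtype.map_injective h Function.injective_id)
  gcongr

lemma uprob_eq_one [Finite Ω] [Nonempty Ω] {p : Ω → Prop} (h : ∀ ω, p ω) : uprob p = 1 := by
  have : Nat.card {ω // p ω} = Nat.card Ω := Nat.card_congr (Equiv.subtypeUnivEquiv h)
  rw [uprob, this, div_self]
  exact_mod_cast Nat.card_pos.ne'

lemma uprob_le_one [Finite Ω] [Nonempty Ω] (p : Ω → Prop) : uprob p ≤ 1 :=
  (uprob_mono (q := fun _ => True) (by simp)).trans (uprob_eq_one (by simp)).le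

lemma uprob_eq_zero {p : Ω → Prop} (h : ∀ ω, ¬ p ω) : uprob p = 0 := by
  have : IsEmpty {ω // p ω} := ⟨fun ω => h _ ω.2⟩
  simp [uprob]

lemma uprob_split [Finite Ω] (p q : Ω → Prop) :
    uprob p = uprob (fun ω => p ω ∧ q ω) + uprob (fun ω => p ω ∧ ¬ q ω) := by
  classical
  have := Fintype.ofFinite Ω
  have h := Finset.card_filter_add_card_filter_not (s := Finset.univ.filter p) q
  rw [Finset.filter_filter, Finset.filter_filter] at h
  simp only [uprob, ← add_div, Nat.card_eq_fintype_card, Fintype.card_subtype, ← h]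
  push_cast
  rfl

lemma uprob_not [Finite Ω] [Nonempty Ω] (p : Ω → Prop) : uprob (fun ω => ¬ p ω) = 1 - uprob p := by
  have h := uprob_split (fun _ : Ω => True) p
  rw [uprob_eq_one (by simp)] at h
  simp only [true_and] at h
  linarith

lemma uprob_comp_bijective {f : Ω → Ω'} (hf : f.Bijective) (p : Ω' → Prop) :
    uprob (fun ω => p (f ω)) = uprob p := by
  have h1 : Nat.card {ω // p (f ω)} = Nat.card {ω // p ω} :=
    Nat.card_congr ((Equiv.ofBijective f hf).subtypeEquiv fun _ => Iff.rfl)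
  rw [uprob, uprob, h1, Nat.card_congr (Equiv.ofBijective f hf)]

lemma uprob_prod (p : Ω → Prop) (q : Ω' → Prop) :
    uprob (fun ω : Ω × Ω' => p ω.1 ∧ q ω.2) = uprob p * uprob q := by
  have h1 : Nat.card {ω : Ω × Ω' // p ω.1 ∧ q ω.2} =
      Nat.card ({ω // p ω} × {ω // q ω}) := Nat.card_congr (Equiv.subtypeProdEquivProd)
  rw [uprob, uprob, uprob, h1, Nat.card_prod, Nat.card_prod]
  push_cast
  rw [mul_div_mul_comm]

lemma sum_uprob_eq [Finite Ω] [Nonempty Ω] {S : Type} [Fintype S] (f : Ω → S) :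
    ∑ s, uprob (fun ω => f ω = s) = 1 := by
  simp only [uprob]
  rw [← Finset.sum_div, ← Nat.cast_sum, ← Nat.card_sigma,
    Nat.card_congr (Equiv.sigmaFiberEquiv f), div_self]
  exact_mod_cast Nat.card_pos.ne'

lemma uniformMeasure_real [Fintype Ω] [Nonempty Ω] (p : Ω → Prop) :
    (@PMF.toMeasure Ω ⊤ (PMF.uniformOfFintype Ω)).real {s | p s} = uprob p := by
  classical
  let _ : MeasurableSpace Ω := ⊤
  rw [Measure.real, PMF.toMeasure_uniformOfFintype_apply _ MeasurableSpace.measurableSet_top, uprob]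
  simp [ENNReal.toReal_div, Fintype.card_subtype]

end UniformProbability

/-! ### Chains driven by finitely many uniform random variables -/

section Noise

variable {S N Q : Type}

/-- The trajectory started in `x` that applies the time-dependent update rule `F` to the noise
`ω 0, …, ω (T - 1)` and does not move after time `T`. -/
def noiseTraj {T : ℕ} (F : ℕ → Q → N → Q) (x : Q) (ω : Fin T → N) : ℕ → Q
  | 0 => x
  | n + 1 => if h : n < T then F n (noiseTraj F x ω n) (ω ⟨n, h⟩) else noiseTraj F x ω n

lemma noiseTraj_succ {T : ℕ} (F : ℕ → Q → N → Q) (x : Q) (ω : Fin T → N) {n : ℕ} (h : n < T) :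
    noiseTraj F x ω (n + 1) = F n (noiseTraj F x ω n) (ω ⟨n, h⟩) := by
  simp [noiseTraj, h]

lemma noiseTraj_of_le {T : ℕ} (F : ℕ → Q → N → Q) (x : Q) (ω : Fin T → N) {n : ℕ} (h : T ≤ n) :
    noiseTraj F x ω n = noiseTraj F x ω T := by
  induction n, h using Nat.le_induction with
  | base => rfl
  | succ n hn ih => simp [noiseTraj, hn, ih]

lemma noiseTraj_congr {T : ℕ} (F : ℕ → Q → N → Q) (x : Q) {ω ω' : Fin T → N} {n : ℕ}
    (h : ∀ i : Fin T, (i : ℕ) < n → ω i = ω' i) : noiseTraj F x ω n = noiseTraj F x ω' n := by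
  induction n with
  | zero => rfl
  | succ n ih =>
    have h' := ih fun i hi => h i (by omega)
    by_cases hn : n < T
    · rw [noiseTraj_succ F x ω hn, noiseTraj_succ F x ω' hn, h', h ⟨n, hn⟩ (by simp)]
    · simp [noiseTraj, hn, h']

/-- The transition matrix of the random map `s ↦ f s a` with `a` uniform. -/
noncomputable def noiseMatrix (f : S → N → S) : Matrix S S ℝ :=
  fun s t => uprob fun a => f s a = t

lemma noiseMatrix_mem_rowStochastic [Finite N] [Nonempty N] [Fintype S] [DecidableEq S]
    (f : S → N → S) : noiseMatrix f ∈ Matrix.rowStochastic ℝ S := by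
  rw [Matrix.mem_rowStochastic_iff_sum]
  exact ⟨fun s t => uprob_nonneg _, fun s => sum_uprob_eq (f s)⟩

/-- The coordinate `ω n` is uniform and independent of the earlier coordinates. -/
lemma uprob_past_and_coord {T : ℕ} (n : Fin T) (E : (Fin T → N) → Prop) (B : N → Prop)
    [Finite N] [Nonempty N]
    (hE : ∀ ω ω' : Fin T → N, (∀ i, i < n → ω i = ω' i) → E ω → E ω') :
    uprob (fun ω : Fin T → N => E ω ∧ B (ω n)) = uprob E * uprob B := by
  -- exchanging `ω n` with a fresh uniform variable preserves the uniform distribution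
  let e : (Fin T → N) × N → (Fin T → N) × N := fun p => (Function.update p.1 n p.2, p.1 n)
  have he : Function.Bijective e :=
    Function.Involutive.bijective fun p => by simp [e]
  rw [← uprob_prod, ← uprob_comp_bijective he, ← mul_one (uprob fun ω => E ω ∧ B (ω n)),
    ← uprob_eq_one (p := fun _ : N => True) (by simp), ← uprob_prod]
  refine uprob_congr fun p => ?_
  simp only [e, and_true]
  refine and_congr_left fun _ => ⟨hE _ _ fun i hi => ?_, hE _ _ fun i hi => ?_⟩ <;>
    simp [hi.ne]

/-- A noise trajectory is a Markov chain, and so is its composition with a bijection of the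
noise, which preserves the uniform measure. Since the noise ends at time `T`, the states reached by
then have to be absorbing. -/
lemma isMarkovChainFrom_noiseTraj [Fintype N] [Nonempty N] {T : ℕ} (f : S → N → S) (x : S)
    (hfix : ∀ ω : Fin T → N, ∀ a, f (noiseTraj (fun _ => f) x ω T) a =
      noiseTraj (fun _ => f) x ω T) {Φ : (Fin T → N) → Fin T → N} (hΦ : Function.Bijective Φ) :
    @IsMarkovChainFrom _ _ ⊤ (noiseMatrix f) x
      (@PMF.toMeasure _ ⊤ (PMF.uniformOfFintype (Fin T → N)))
      fun n ω => noiseTraj (fun _ => f) x (Φ ω) n := by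
  let _ : MeasurableSpace (Fin T → N) := ⊤
  set Z : (Fin T → N) → ℕ → S := noiseTraj (fun _ => f) x with hZ
  refine ⟨fun n s => trivial, ae_of_all _ fun ω => rfl, fun n s => ?_⟩
  rw [uniformMeasure_real, uniformMeasure_real,
    uprob_comp_bijective hΦ fun ω => ∀ i ≤ n + 1, Z ω i = s i,
    uprob_comp_bijective hΦ fun ω => ∀ i ≤ n, Z ω i = s i]
  have hsplit : ∀ ω, (∀ i ≤ n + 1, Z ω i = s i) ↔
      (∀ i ≤ n, Z ω i = s i) ∧ Z ω (n + 1) = s (n + 1) := fun ω =>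
    ⟨fun h => ⟨fun i hi => h i (by omega), h _ le_rfl⟩, fun h i hi => by
      rcases Nat.le_succ_iff.1 hi with hi | rfl
      · exact h.1 i hi
      · exact h.2⟩
  by_cases hn : n < T
  · have hc := uprob_past_and_coord ⟨n, hn⟩ (fun ω => ∀ i ≤ n, Z ω i = s i)
      (fun a => f (s n) a = s (n + 1)) (fun ω ω' h hω i hi => by
        rw [← hω i hi]
        exact (noiseTraj_congr _ x fun j hj => h j (Fin.mk_lt_mk.2 (by omega))).symm)
    refine Eq.trans (uprob_congr fun ω => ?_) hc
    rw [hsplit, hZ, noiseTraj_succ _ _ _ hn, ← hZ]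
    exact and_congr_right fun h => by rw [h n le_rfl]
  · have hst : ∀ ω, (∀ i ≤ n, Z ω i = s i) → Z ω T = s n := fun ω h => by
      rw [← h n le_rfl]
      exact (noiseTraj_of_le _ x ω (not_lt.1 hn)).symm
    have hnext : ∀ ω, Z ω (n + 1) = Z ω T := fun ω => noiseTraj_of_le _ x ω (by omega)
    by_cases hex : ∃ ω, ∀ i ≤ n, Z ω i = s i
    · obtain ⟨ω₀, h₀⟩ := hex
      have hf : ∀ a, f (s n) a = s n := fun a => by
        rw [← hst ω₀ h₀]
        exact hfix ω₀ a
      by_cases hs : s n = s (n + 1)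
      · rw [noiseMatrix, uprob_eq_one fun a => (hf a).trans hs, mul_one]
        refine uprob_congr fun ω => ?_
        rw [hsplit]
        exact and_iff_left_of_imp fun h => by rw [hnext, hst ω h, hs]
      · rw [noiseMatrix, uprob_eq_zero fun a h => hs ((hf a).symm.trans h), mul_zero]
        refine uprob_eq_zero fun ω h => hs ?_
        obtain ⟨h3, h4⟩ := (hsplit ω).1 h
        rw [← h4, hnext, hst ω h3]
    · rw [uprob_eq_zero fun ω h => hex ⟨ω, h⟩,
        uprob_eq_zero fun ω h => hex ⟨ω, ((hsplit ω).1 h).1⟩, zero_mul]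

/-- A time-dependent update rule on a finite set `R`, together with a bijection `Φ` of the noise
that makes two trajectories meet, yields a time-homogeneous chain (with the time as part of its
state) whose two copies meet, and whose total variation limit is at least the difference of the
probabilities of any terminal state. -/
theorem exists_chain_of_noiseTraj_meet [Finite N] [Nonempty N] (T : ℕ) (R : Set Q)
    (hR : R.Finite) (F : ℕ → Q → N → Q) (hF : ∀ t, ∀ q ∈ R, ∀ a, F t q a ∈ R) {x y : Q}
    (hx : x ∈ R) (hy : y ∈ R) (Φ : (Fin T → N) → Fin T → N) (hΦ : Function.Injective Φ)
    (hmeet : ∀ ω, ∃ n, noiseTraj F x ω n = noiseTraj F y (Φ ω) n) :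
    ∃ (S : Type) (_ : Fintype S) (_ : DecidableEq S) (P : Matrix S S ℝ) (x' y' : S),
      P ∈ Matrix.rowStochastic ℝ S ∧ CanBeCoupledToMeet P x' y' ∧
      ∀ l, HasTVLimit P x' y' l → ∀ q : Q,
        uprob (fun ω : Fin T → N => noiseTraj F x ω T = q) -
          uprob (fun ω : Fin T → N => noiseTraj F y ω T = q) ≤ l := by
  classical
  have := Fintype.ofFinite N
  let A : Set (ℕ × Q) := Set.Iic T ×ˢ R
  have hA : A.Finite := (Set.finite_Iic T).prod hR
  let f : A → N → A := fun s a =>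
    if h : s.1.1 < T then ⟨(s.1.1 + 1, F s.1.1 s.1.2 a), h, hF _ _ s.2.2 _⟩ else s
  have hf1 : ∀ (s : A) (a : N), s.1.1 < T → (f s a).1 = (s.1.1 + 1, F s.1.1 s.1.2 a) :=
    fun s a h => by simp only [f, h, dite_true]
  have hf2 : ∀ (s : A) (a : N), ¬ s.1.1 < T → f s a = s :=
    fun s a h => by simp only [f, h, dite_false]
  have := hA.fintype
  let start : ∀ z, z ∈ R → A := fun z hz => ⟨(0, z), Nat.zero_le _, hz⟩
  have htraj : ∀ {z} (hz : z ∈ R) (ω : Fin T → N) (n : ℕ), n ≤ T →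
      (noiseTraj (fun _ => f) (start z hz) ω n).1 = (n, noiseTraj F z ω n) := by
    intro z hz ω n
    induction n with
    | zero => intro _; rfl
    | succ n ih =>
      intro hn
      have ih := ih (by omega)
      rw [noiseTraj_succ _ _ _ hn, noiseTraj_succ _ _ _ hn, hf1 _ _ (by rw [ih]; exact hn), ih]
  have hfix : ∀ {z} (hz : z ∈ R) (ω : Fin T → N) (a : N),
      f (noiseTraj (fun _ => f) (start z hz) ω T) a = noiseTraj (fun _ => f) (start z hz) ω T :=
    fun hz ω a => hf2 _ _ (by rw [htraj hz ω T le_rfl]; exact lt_irrefl _)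
  have hM := fun {z} (hz : z ∈ R) {Φ} (hΦ : Function.Bijective Φ) =>
    isMarkovChainFrom_noiseTraj f (start z hz) (hfix hz) (Φ := Φ) hΦ
  have hP := noiseMatrix_mem_rowStochastic f
  let _ : MeasurableSpace (Fin T → N) := ⊤
  refine ⟨A, inferInstance, inferInstance, noiseMatrix f, start x hx, start y hy, hP,
    ⟨Fin T → N, ⊤, _, _, _, inferInstance, hM hx Function.bijective_id,
      hM hy (Finite.injective_iff_bijective.1 hΦ), ae_of_all _ fun ω => ?_⟩, fun l hl q => ?_⟩
  · obtain ⟨n, hn⟩ := hmeet ω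
    have key : ∀ n ≤ T, noiseTraj F x ω n = noiseTraj F y (Φ ω) n →
        noiseTraj (fun _ => f) (start x hx) ω n =
          noiseTraj (fun _ => f) (start y hy) (Φ ω) n := fun n hn h =>
      Subtype.ext (by rw [htraj hx ω n hn, htraj hy (Φ ω) n hn, h])
    rcases le_total n T with h | h
    · exact ⟨n, key n h hn⟩
    · rw [noiseTraj_of_le F x ω h, noiseTraj_of_le F y (Φ ω) h] at hn
      exact ⟨T, key T le_rfl hn⟩
  · refine le_of_tendsto_of_tendsto' tendsto_const_nhds
      ((tendsto_add_atTop_iff_nat T).2 hl) fun n => ?_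
    by_cases hq : q ∈ R
    · have hval : ∀ {z} (hz : z ∈ R),
          (noiseMatrix f ^ (n + T)) (start z hz) ⟨(T, q), Set.mem_Iic.2 le_rfl, hq⟩ =
          uprob (fun ω : Fin T → N => noiseTraj F z ω T = q) := by
        intro z hz
        rw [← (hM hz Function.bijective_id).measureReal_eq_pow, uniformMeasure_real]
        refine uprob_congr fun ω => ?_
        rw [id, noiseTraj_of_le _ _ _ (Nat.le_add_left T n), Subtype.ext_iff,
          htraj hz ω T le_rfl]
        simp
      rw [← hval hx, ← hval hy]
      have := abs_sum_sub_sum_le_tvDist ((noiseMatrix f ^ (n + T)) (start x hx))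
        ((noiseMatrix f ^ (n + T)) (start y hy)) {⟨(T, q), Set.mem_Iic.2 le_rfl, hq⟩}
      simp only [Finset.sum_singleton] at this
      exact (le_abs_self _).trans this
    · have hz : ∀ {z} (hz : z ∈ R), uprob (fun ω : Fin T → N => noiseTraj F z ω T = q) = 0 :=
        fun hz => uprob_eq_zero fun ω h => hq (by
          have := (noiseTraj (fun _ => f) (start _ hz) ω T).2.2
          rw [htraj hz ω T le_rfl, h] at this
          exact this)
      rw [hz hx, hz hy, sub_zero]
      exact tvDist_nonneg _ _

end Noise

/-! ### Simple random walk absorbed at `±H` -/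

section Walk

/-- One step of the walk: `±1` according to the bit `b`, unless `v` is outside `(-H, H)`. -/
def walkStep (H v : ℤ) (b : Bool) : ℤ :=
  if |v| < H then (if b then v + 1 else v - 1) else v

/-- The walk started in `z` that is driven by the bits `c` and absorbed outside `(-H, H)`. -/
def walk (H z : ℤ) (c : ℕ → Bool) : ℕ → ℤ
  | 0 => z
  | n + 1 => walkStep H (walk H z c n) (c n)

/-- Prefix a bit to a sequence of bits. -/
def consBit (b : Bool) (c : ℕ → Bool) : ℕ → Bool
  | 0 => b
  | n + 1 => c n

/-- Continue finitely many bits by `false`. -/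
def extendBits {T : ℕ} (c : Fin T → Bool) (i : ℕ) : Bool :=
  if h : i < T then c ⟨i, h⟩ else false

variable {H z : ℤ} {c : ℕ → Bool}

lemma abs_walkStep_le {v : ℤ} (hv : |v| ≤ H) (b : Bool) : |walkStep H v b| ≤ H := by
  unfold walkStep
  split_ifs <;> rw [abs_le] at * <;> rw [abs_lt] at * <;> omega

lemma abs_walk_le (hz : |z| ≤ H) (n : ℕ) : |walk H z c n| ≤ H := by
  induction n with
  | zero => exact hz
  | succ n ih => exact abs_walkStep_le ih _

lemma walk_cons (b : Bool) (n : ℕ) :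
    walk H z (consBit b c) (n + 1) = walk H (walkStep H z b) c n := by
  induction n with
  | zero => rfl
  | succ n ih =>
    rw [walk, ih]
    rfl

lemma walkStep_neg (v : ℤ) (b : Bool) : walkStep H (-v) (!b) = -walkStep H v b := by
  unfold walkStep
  cases b <;> simp <;> split_ifs <;> ring

lemma walk_neg (n : ℕ) : walk H (-z) (fun i => !c i) n = -walk H z c n := by
  induction n with
  | zero => rfl
  | succ n ih => rw [walk, ih, walkStep_neg, walk]

lemma walk_congr {c' : ℕ → Bool} {n : ℕ} (h : ∀ i < n, c i = c' i) :
    walk H z c n = walk H z c' n := by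
  induction n with
  | zero => rfl
  | succ n ih => rw [walk, walk, ih fun i hi => h i (by omega), h n (by omega)]

lemma walk_of_absorbed {n m : ℕ} (h : H ≤ |walk H z c n|) (hnm : n ≤ m) :
    walk H z c m = walk H z c n := by
  induction m, hnm using Nat.le_induction with
  | base => rfl
  | succ m _ ih => rw [walk, ih, walkStep, if_neg (not_lt.2 h)]

lemma abs_walk_lt_of_le {n m : ℕ} (h : |walk H z c m| < H) (hnm : n ≤ m) : |walk H z c n| < H := by
  by_contra! h'
  rw [walk_of_absorbed h' hnm] at h
  omega

/-- The walk is skip-free. -/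
lemma exists_walk_eq {v : ℤ} (hv : v ≤ z) {n : ℕ} (h : walk H z c n ≤ v) :
    ∃ i ≤ n, walk H z c i = v := by
  induction n with
  | zero => exact ⟨0, le_rfl, le_antisymm h hv⟩
  | succ n ih =>
    by_cases h' : walk H z c n ≤ v
    · obtain ⟨i, hi, he⟩ := ih h'
      exact ⟨i, by omega, he⟩
    · refine ⟨n + 1, le_rfl, ?_⟩
      rw [walk] at h ⊢
      unfold walkStep at h ⊢
      split_ifs at h ⊢ <;> omega

end Walk

section WalkProbability

/-- The probability of an event under `T` independent fair bits. -/
noncomputable def bitProb (T : ℕ) (E : (ℕ → Bool) → Prop) : ℝ :=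
  uprob fun c : Fin T → Bool => E (extendBits c)

lemma bitProb_succ (T : ℕ) (E : (ℕ → Bool) → Prop) :
    bitProb (T + 1) E = (bitProb T (fun c => E (consBit true c)) +
      bitProb T (fun c => E (consBit false c))) / 2 := by
  have hcons : ∀ (b : Bool) (c : Fin T → Bool),
      extendBits (Fin.cons b c : Fin (T + 1) → Bool) = consBit b (extendBits c) := by
    intro b c
    funext i
    cases i with
    | zero => simp [extendBits, consBit]
    | succ i =>
      simp only [extendBits, consBit, Nat.add_lt_add_iff_right]
      split_ifs with h
      · exact Fin.cons_succ (α := fun _ => Bool) b c ⟨i, h⟩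
      · rfl
  have hbij : Function.Bijective fun p : Bool × (Fin T → Bool) =>
      (Fin.cons p.1 p.2 : Fin (T + 1) → Bool) :=
    (Fin.consEquiv fun _ : Fin (T + 1) => Bool).bijective
  have hhalf : ∀ b : Bool, uprob (fun a : Bool => a = b) = 1 / 2 := by
    intro b
    simp [uprob]
  have hb : ∀ b : Bool, uprob (fun p : Bool × (Fin T → Bool) =>
      p.1 = b ∧ E (consBit b (extendBits p.2))) =
        bitProb T (fun c => E (consBit b c)) / 2 := fun b => by
    rw [uprob_prod (fun a : Bool => a = b) fun c => E (consBit b (extendBits c)), hhalf, bitProb]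
    ring
  rw [bitProb, ← uprob_comp_bijective hbij, uprob_split _ fun p => p.1 = true, add_div, ← hb, ← hb]
  congr 1 <;> refine uprob_congr fun ⟨b, c⟩ => ?_ <;> cases b <;> simp [hcons]

lemma bitProb_mono {T : ℕ} {E E' : (ℕ → Bool) → Prop} (h : ∀ c, E c → E' c) :
    bitProb T E ≤ bitProb T E' := uprob_mono fun _ => h _

lemma bitProb_congr {T : ℕ} {E E' : (ℕ → Bool) → Prop} (h : ∀ c, E c ↔ E' c) :
    bitProb T E = bitProb T E' := uprob_congr fun _ => h _

lemma bitProb_le_one {T : ℕ} (E : (ℕ → Bool) → Prop) : bitProb T E ≤ 1 := uprob_le_one _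

lemma bitProb_nonneg {T : ℕ} (E : (ℕ → Bool) → Prop) : 0 ≤ bitProb T E := uprob_nonneg _

variable {H : ℤ}

/-- Gambler's ruin: the walk reaches `H` by time `n` without visiting `b` with probability at most
`(u - b) / (H - b)`. -/
lemma bitProb_reach_top_le {b : ℤ} (hb : -H ≤ b) (hbH : b < H) (n T : ℕ) (hn : n ≤ T) (u : ℤ)
    (hu : b ≤ u) (huH : u ≤ H) :
    (H - b) * bitProb T (fun c => walk H u c n = H ∧ ∀ i ≤ n, b < walk H u c i) ≤ u - b := by
  have hpos : (0 : ℝ) < H - b := by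
    have : (b : ℝ) < H := by exact_mod_cast hbH
    linarith
  induction n generalizing T u with
  | zero =>
    rcases huH.eq_or_lt with rfl | h
    · exact mul_le_of_le_one_right hpos.le (bitProb_le_one _)
    · rw [bitProb, uprob_eq_zero fun c hc => h.ne hc.1, mul_zero]
      have : (b : ℝ) ≤ u := by exact_mod_cast hu
      linarith
  | succ n ih =>
    rcases huH.eq_or_lt with rfl | h
    · exact mul_le_of_le_one_right hpos.le (bitProb_le_one _)
    rcases hu.eq_or_lt with rfl | h'
    · rw [bitProb, uprob_eq_zero fun c hc => (hc.2 0 (Nat.zero_le _)).ne rfl, mul_zero]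
      simp
    obtain ⟨T, rfl⟩ : ∃ T', T = T' + 1 := ⟨T - 1, by omega⟩
    have habs : |u| < H := by rw [abs_lt]; omega
    have hmono : ∀ a : Bool, bitProb T (fun c => walk H u (consBit a c) (n + 1) = H ∧
        ∀ i ≤ n + 1, b < walk H u (consBit a c) i) ≤
        bitProb T (fun c => walk H (walkStep H u a) c n = H ∧
          ∀ i ≤ n, b < walk H (walkStep H u a) c i) := fun a =>
      bitProb_mono fun c hc => ⟨by rw [← walk_cons, hc.1], fun i hi => by
        rw [← walk_cons]
        exact hc.2 (i + 1) (by omega)⟩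
    have h1 := ih T (by omega) (u + 1) (by omega) (by omega)
    have h2 := ih T (by omega) (u - 1) (by omega) (by omega)
    have h3 := hmono true
    have h4 := hmono false
    simp only [walkStep, habs, if_true, Bool.false_eq_true, if_false] at h3 h4
    rw [bitProb_succ]
    push_cast at h1 h2
    have h5 := mul_le_mul_of_nonneg_left h3 hpos.le
    have h6 := mul_le_mul_of_nonneg_left h4 hpos.le
    linarith

/-- `walk ^ 2 - n` is a martingale until absorption, so the expected time spent in `(-H, H)` is at
most `H ^ 2 - u ^ 2`. -/
lemma sum_bitProb_alive_le (n T : ℕ) (hn : n ≤ T) (u : ℤ) (hu : |u| ≤ H) :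
    ∑ k ∈ Finset.range n, bitProb T (fun c => |walk H u c k| < H) ≤ (H : ℝ) ^ 2 - u ^ 2 := by
  induction n generalizing T u with
  | zero =>
    have : (u : ℝ) ^ 2 ≤ (H : ℝ) ^ 2 := by exact_mod_cast sq_le_sq' (abs_le.1 hu).1 (abs_le.1 hu).2
    simpa using this
  | succ n ih =>
    obtain ⟨T, rfl⟩ : ∃ T', T = T' + 1 := ⟨T - 1, by omega⟩
    rcases hu.eq_or_lt with h | h
    · have h0 : ∀ k, bitProb (T + 1) (fun c => |walk H u c k| < H) = 0 := fun k =>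
        uprob_eq_zero fun c hc => by
          have := abs_walk_lt_of_le hc (Nat.zero_le k)
          rw [walk] at this
          omega
      have h' : (H : ℝ) ^ 2 = u ^ 2 := by
        rw [← h]; push_cast; exact sq_abs _
      simp [h0, h']
    · have h' := abs_lt.1 h
      have h1 := ih T (by omega) (u + 1) (by rw [abs_le]; omega)
      have h2 := ih T (by omega) (u - 1) (by rw [abs_le]; omega)
      rw [Finset.sum_range_succ']
      have h3 := bitProb_le_one (T := T + 1) (fun c => |walk H u c 0| < H)
      simp only [bitProb_succ, walk_cons, walkStep, h, if_true, Bool.false_eq_true,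
        if_false] at h3 ⊢
      rw [← Finset.sum_div, Finset.sum_add_distrib]
      push_cast at h1 h2
      linarith

/-- The expected time until absorption is at most `H ^ 2`, hence the walk is still alive at time
`n` with probability at most `H ^ 2 / n`. -/
lemma mul_bitProb_alive_le (n T : ℕ) (hn : n ≤ T) (u : ℤ) (hu : |u| ≤ H) :
    n * bitProb T (fun c => |walk H u c n| < H) ≤ (H : ℝ) ^ 2 := by
  have h := sum_bitProb_alive_le n T hn u hu
  have h1 : ∑ k ∈ Finset.range n, bitProb T (fun c => |walk H u c n| < H) ≤
      ∑ k ∈ Finset.range n, bitProb T (fun c => |walk H u c k| < H) :=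
    Finset.sum_le_sum fun k hk =>
      bitProb_mono fun c hc => abs_walk_lt_of_le hc (Finset.mem_range.1 hk).le
  rw [Finset.sum_const, Finset.card_range, nsmul_eq_mul] at h1
  have := sq_nonneg (u : ℝ)
  linarith

end WalkProbability

/-! ### Surviving walks: crossing the origin against staying positive -/

section Surviving

/-- The probability that the walk in `(0, H)`, killed outside, goes from `u` to `v` in `n` steps,
provided that `v` is in `(0, H)`. -/
noncomputable def posProb (H : ℤ) : ℕ → ℤ → ℤ → ℝ
  | 0, u, v => if u = v ∧ 0 < u then 1 else 0
  | n + 1, u, v => if 0 < u ∧ u < H then (posProb H n (u + 1) v + posProb H n (u - 1) v) / 2 else 0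

/-- The probability that the walk in `(-H, H)`, killed outside, goes from `u` to `v` in `n` steps,
provided that `v` is in `(-H, H)`. -/
noncomputable def aliveProb (H : ℤ) : ℕ → ℤ → ℤ → ℝ
  | 0, u, v => if u = v then 1 else 0
  | n + 1, u, v => if |u| < H then (aliveProb H n (u + 1) v + aliveProb H n (u - 1) v) / 2 else 0

variable {H : ℤ}

lemma posProb_nonneg (n : ℕ) (u v : ℤ) : 0 ≤ posProb H n u v := by
  induction n generalizing u with
  | zero => unfold posProb; split_ifs <;> norm_num
  | succ n ih =>
    unfold posProb
    split_ifs
    · linarith [ih (u + 1), ih (u - 1)]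
    · exact le_rfl

lemma posProb_le_one (n : ℕ) (u v : ℤ) : posProb H n u v ≤ 1 := by
  induction n generalizing u with
  | zero => unfold posProb; split_ifs <;> norm_num
  | succ n ih =>
    unfold posProb
    split_ifs
    · linarith [ih (u + 1), ih (u - 1)]
    · exact zero_le_one

lemma aliveProb_nonneg (n : ℕ) (u v : ℤ) : 0 ≤ aliveProb H n u v := by
  induction n generalizing u with
  | zero => unfold aliveProb; split_ifs <;> norm_num
  | succ n ih =>
    unfold aliveProb
    split_ifs
    · linarith [ih (u + 1), ih (u - 1)]
    · exact le_rfl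

lemma posProb_le_aliveProb (n : ℕ) (u v : ℤ) : posProb H n u v ≤ aliveProb H n u v := by
  induction n generalizing u with
  | zero =>
    unfold posProb aliveProb
    split_ifs with h h' h'
    · exact le_rfl
    · exact absurd h.1 h'
    · exact zero_le_one
    · exact le_rfl
  | succ n ih =>
    unfold posProb aliveProb
    split_ifs with h h' h'
    · linarith [ih (u + 1), ih (u - 1)]
    · exact absurd (abs_lt.2 ⟨by omega, by omega⟩) h'
    · linarith [aliveProb_nonneg (H := H) n (u + 1) v, aliveProb_nonneg (H := H) n (u - 1) v]
    · exact le_rfl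

lemma aliveProb_neg (n : ℕ) (u v : ℤ) : aliveProb H n (-u) (-v) = aliveProb H n u v := by
  induction n generalizing u with
  | zero => simp [aliveProb]
  | succ n ih =>
    unfold aliveProb
    rw [abs_neg, ← ih (u + 1), ← ih (u - 1), neg_add, neg_sub, add_comm (aliveProb H n (-u + 1) _)]
    congr 4; ring

lemma posProb_eq_zero {v : ℤ} (hv0 : 0 < v) (hvH : v < H) (n : ℕ) (u : ℤ)
    (hu : ¬ (0 < u ∧ u < H)) :
    posProb H n u v = 0 := by
  cases n with
  | zero =>
    unfold posProb
    rw [if_neg]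
    rintro ⟨rfl, h⟩
    exact hu ⟨hv0, hvH⟩
  | succ n =>
    unfold posProb
    rw [if_neg hu]

lemma aliveProb_eq_zero {v : ℤ} (hv : |v| < H) (n : ℕ) (u : ℤ) (hu : ¬ |u| < H) :
    aliveProb H n u v = 0 := by
  cases n with
  | zero =>
    unfold aliveProb
    rw [if_neg]
    rintro rfl
    exact hu hv
  | succ n =>
    unfold aliveProb
    rw [if_neg hu]

/-- Chapman–Kolmogorov equation. -/
lemma posProb_add {v : ℤ} (hv0 : 0 < v) (hvH : v < H) (k l : ℕ) (u : ℤ) :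
    posProb H (k + l) u v = ∑ w ∈ Finset.Ioo 0 H, posProb H k u w * posProb H l w v := by
  induction k generalizing u with
  | zero =>
    rw [zero_add]
    by_cases hu : 0 < u ∧ u < H
    · rw [Finset.sum_eq_single u]
      · simp [posProb, hu.1]
      · intro w _ hw
        simp [posProb, hw.symm]
      · intro h
        exact absurd (Finset.mem_Ioo.2 hu) h
    · rw [posProb_eq_zero hv0 hvH l u hu]
      refine (Finset.sum_eq_zero fun w hw => ?_).symm
      rw [Finset.mem_Ioo] at hw
      rw [posProb, if_neg, zero_mul]
      rintro ⟨rfl, _⟩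
      exact hu hw
  | succ k ih =>
    rw [Nat.add_right_comm]
    simp only [posProb]
    split_ifs with h
    · rw [ih, ih, ← Finset.sum_add_distrib, Finset.sum_div]
      exact Finset.sum_congr rfl fun w _ => by ring
    · simp

/-- Chapman–Kolmogorov equation. -/
lemma aliveProb_add {v : ℤ} (hv : |v| < H) (k l : ℕ) (u : ℤ) :
    aliveProb H (k + l) u v =
      ∑ w ∈ Finset.Ioo (-H) H, aliveProb H k u w * aliveProb H l w v := by
  induction k generalizing u with
  | zero =>
    rw [zero_add]
    by_cases hu : |u| < H
    · rw [Finset.sum_eq_single u]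
      · simp [aliveProb]
      · intro w _ hw
        simp [aliveProb, hw.symm]
      · intro h
        exact absurd (Finset.mem_Ioo.2 (abs_lt.1 hu)) h
    · rw [aliveProb_eq_zero hv l u hu]
      refine (Finset.sum_eq_zero fun w hw => ?_).symm
      rw [aliveProb, if_neg, zero_mul]
      rintro rfl
      exact hu (abs_lt.2 (Finset.mem_Ioo.1 hw))
  | succ k ih =>
    rw [Nat.add_right_comm]
    simp only [aliveProb]
    split_ifs with h
    · rw [ih, ih, ← Finset.sum_add_distrib, Finset.sum_div]
      exact Finset.sum_congr rfl fun w _ => by ring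
    · simp

/-- A surviving path from `u > 0` to `-v < 0` can cross the origin only after time `k` or only
before it; these two families of paths are disjoint. -/
lemma le_aliveProb_add {u v : ℤ} (hv0 : 0 < v) (hvH : v < H) (k l : ℕ) :
    ∑ w ∈ Finset.Ioo 0 H, (posProb H k u w * aliveProb H l w (-v) +
      aliveProb H k u (-w) * posProb H l w v) ≤ aliveProb H (k + l) u (-v) := by
  rw [aliveProb_add (by rw [abs_neg, abs_lt]; omega), Finset.sum_add_distrib]
  have hneg : ∑ w ∈ Finset.Ioo 0 H, aliveProb H k u (-w) * posProb H l w v ≤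
      ∑ w ∈ Finset.Ioo (-H) 0, aliveProb H k u w * aliveProb H l w (-v) := by
    have : ∑ w ∈ Finset.Ioo (-H) 0, aliveProb H k u w * aliveProb H l w (-v) =
        ∑ w ∈ Finset.Ioo 0 H, aliveProb H k u (-w) * aliveProb H l (-w) (-v) :=
      Finset.sum_bij' (fun w _ => -w) (fun w _ => -w) (by simp; omega) (by simp; omega)
        (by simp) (by simp) (by simp)
    rw [this]
    refine Finset.sum_le_sum fun w _ => ?_
    rw [aliveProb_neg]
    exact mul_le_mul_of_nonneg_left (posProb_le_aliveProb _ _ _) (aliveProb_nonneg _ _ _)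
  have hpos : ∑ w ∈ Finset.Ioo 0 H, posProb H k u w * aliveProb H l w (-v) ≤
      ∑ w ∈ Finset.Ioo 0 H, aliveProb H k u w * aliveProb H l w (-v) :=
    Finset.sum_le_sum fun w _ =>
      mul_le_mul_of_nonneg_right (posProb_le_aliveProb _ _ _) (aliveProb_nonneg _ _ _)
  refine (add_le_add hpos hneg).trans ?_
  rw [← Finset.sum_union]
  · refine Finset.sum_le_sum_of_subset_of_nonneg ?_ fun w _ _ =>
      mul_nonneg (aliveProb_nonneg _ _ _) (aliveProb_nonneg _ _ _)
    intro w
    simp only [Finset.mem_union, Finset.mem_Ioo]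
    omega
  · rw [Finset.disjoint_left]
    intro w
    simp only [Finset.mem_Ioo]
    omega

lemma even_of_posProb_ne_zero (n : ℕ) (u v : ℤ) (h : posProb H n u v ≠ 0) :
    Even (u - v + n) := by
  induction n generalizing u with
  | zero =>
    unfold posProb at h
    split_ifs at h with h'
    · simp [h'.1]
    · exact absurd rfl h
  | succ n ih =>
    unfold posProb at h
    split_ifs at h with h'
    · by_cases h1 : posProb H n (u + 1) v = 0
      · have h2 : posProb H n (u - 1) v ≠ 0 := fun h2 => h (by rw [h1, h2]; simp)
        have := ih _ h2
        rw [Int.even_iff] at *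
        push_cast
        omega
      · have := ih _ h1
        rw [Int.even_iff] at *
        push_cast
        omega
    · exact absurd rfl h

/-- Every target of the right parity within distance `n` is reached in `n` steps by some surviving
path. -/
lemma le_aliveProb (hH : 2 ≤ H) (n : ℕ) (u v : ℤ) (hu : |u| < H) (hv : |v| < H)
    (hn : |u - v| ≤ n) (he : Even (u - v + n)) : (1 / 2) ^ n ≤ aliveProb H n u v := by
  induction n generalizing u with
  | zero =>
    have : u = v := by
      have := abs_nonpos_iff.1 (by exact_mod_cast hn : |u - v| ≤ 0)
      omega
    simp [aliveProb, this]
  | succ n ih =>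
    rw [abs_lt] at hu hv
    rw [abs_le] at hn
    rw [Int.even_iff] at he
    push_cast at hn he
    unfold aliveProb
    rw [if_pos (abs_lt.2 hu), pow_succ]
    have h1 := aliveProb_nonneg (H := H) n (u + 1) v
    have h2 := aliveProb_nonneg (H := H) n (u - 1) v
    by_cases hc : u < v ∨ (u = v ∧ u ≤ 0)
    · have := ih (u + 1) (by rw [abs_lt]; omega) (by rw [abs_le]; omega)
        (by rw [Int.even_iff]; omega)
      linarith
    · have := ih (u - 1) (by rw [abs_lt]; omega) (by rw [abs_le]; omega)
        (by rw [Int.even_iff]; omega)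
      linarith

/-- After a long time a surviving path from `u > 0` to `±v` has most likely crossed the origin.
With `k` large enough that every parity-admissible crossing is possible in `k` steps, each further
block of `k` steps adds the same amount to the ratio of the two probabilities. -/
lemma exists_posProb_le_aliveProb (hH : 2 ≤ H) (M : ℕ) :
    ∃ m, M ≤ m ∧ ∀ u v, 0 < u → u < H → 0 < v → v < H →
      posProb H m u v ≤ aliveProb H m u (-v) := by
  obtain ⟨k, hk⟩ : ∃ k : ℕ, (k : ℤ) = 2 * H := ⟨(2 * H).toNat, by omega⟩
  set δ : ℝ := (1 / 2) ^ k with hδ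
  have hδ0 : 0 < δ := by positivity
  have hbase : ∀ u v, 0 < u → u < H → 0 < v → v < H →
      δ * posProb H k u v ≤ aliveProb H k u (-v) := by
    intro u v hu huH hv hvH
    by_cases h : posProb H k u v = 0
    · rw [h, mul_zero]
      exact aliveProb_nonneg _ _ _
    · have he := even_of_posProb_ne_zero _ _ _ h
      refine (mul_le_of_le_one_right hδ0.le (posProb_le_one _ _ _)).trans ?_
      refine le_aliveProb hH k u (-v) (by rw [abs_lt]; omega) (by rw [abs_lt]; omega)
        (by rw [abs_le]; omega) ?_
      rw [Int.even_iff] at *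
      omega
  have hiter : ∀ j : ℕ, ∀ u v, 0 < u → u < H → 0 < v → v < H →
      j * δ * posProb H (j * k) u v ≤ aliveProb H (j * k) u (-v) := by
    intro j
    induction j with
    | zero =>
      intro u v _ _ _ _
      simpa using aliveProb_nonneg _ _ _
    | succ j ih =>
      intro u v hu huH hv hvH
      rw [Nat.succ_mul, Nat.add_comm (j * k) k]
      refine le_trans ?_ (le_aliveProb_add hv hvH k (j * k))
      rw [posProb_add hv hvH, Finset.mul_sum]
      refine Finset.sum_le_sum fun w hw => ?_
      obtain ⟨hw0, hwH⟩ := Finset.mem_Ioo.1 hw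
      have h1 := mul_le_mul_of_nonneg_left (ih w v hw0 hwH hv hvH)
        (posProb_nonneg (H := H) k u w)
      have h2 := mul_le_mul_of_nonneg_right (hbase u w hu huH hw0 hwH)
        (posProb_nonneg (H := H) (j * k) w v)
      push_cast
      linarith
  obtain ⟨j, hj⟩ := exists_nat_ge (1 / δ)
  refine ⟨(j + M) * k, ?_, fun u v hu huH hv hvH => ?_⟩
  · nlinarith [show 1 ≤ k by omega]
  · refine le_trans ?_ (hiter (j + M) u v hu huH hv hvH)
    have h1 : 1 ≤ ((j + M : ℕ) : ℝ) * δ := by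
      rw [div_le_iff₀ hδ0] at hj
      push_cast
      have : 0 ≤ (M : ℝ) * δ := by positivity
      linarith
    exact le_mul_of_one_le_left (posProb_nonneg _ _ _) h1

lemma bitProb_eq_posProb {v : ℤ} (hv0 : 0 < v) (hvH : v < H) (n T : ℕ) (hn : n ≤ T) (u : ℤ) :
    bitProb T (fun c => walk H u c n = v ∧ ∀ i ≤ n, 0 < walk H u c i) = posProb H n u v := by
  induction n generalizing T u with
  | zero =>
    unfold posProb
    split_ifs with h
    · exact uprob_eq_one fun c => ⟨h.1, fun i hi => by rw [Nat.le_zero.1 hi]; exact h.2⟩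
    · exact uprob_eq_zero fun c hc => h ⟨hc.1, hc.2 0 le_rfl⟩
  | succ n ih =>
    obtain ⟨T, rfl⟩ : ∃ T', T = T' + 1 := ⟨T - 1, by omega⟩
    unfold posProb
    split_ifs with h
    · have habs : |u| < H := by rw [abs_lt]; omega
      have key : ∀ a : Bool, bitProb T (fun c => walk H u (consBit a c) (n + 1) = v ∧
          ∀ i ≤ n + 1, 0 < walk H u (consBit a c) i) = posProb H n (walkStep H u a) v := by
        intro a
        rw [← ih T (by omega)]
        refine bitProb_congr fun c => ?_
        rw [walk_cons]
        refine and_congr_right fun _ => ⟨fun h' i hi => ?_, fun h' i hi => ?_⟩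
        · rw [← walk_cons]
          exact h' (i + 1) (by omega)
        · cases i with
          | zero => exact h.1
          | succ i =>
            rw [walk_cons]
            exact h' i (by omega)
      rw [bitProb_succ, key, key]
      simp [walkStep, habs]
    · refine uprob_eq_zero fun c hc => h ⟨hc.2 0 (Nat.zero_le _), ?_⟩
      have h1 : |walk H u (extendBits c) (n + 1)| < H := by rw [hc.1, abs_lt]; omega
      exact (abs_lt.1 (abs_walk_lt_of_le h1 (Nat.zero_le _))).2

lemma bitProb_eq_aliveProb {v : ℤ} (hv : |v| < H) (n T : ℕ) (hn : n ≤ T) (u : ℤ) :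
    bitProb T (fun c => walk H u c n = v) = aliveProb H n u v := by
  induction n generalizing T u with
  | zero =>
    unfold aliveProb
    split_ifs with h
    · exact uprob_eq_one fun c => h
    · exact uprob_eq_zero fun c hc => h hc
  | succ n ih =>
    obtain ⟨T, rfl⟩ : ∃ T', T = T' + 1 := ⟨T - 1, by omega⟩
    unfold aliveProb
    split_ifs with h
    · rw [bitProb_succ, ← ih T (by omega), ← ih T (by omega)]
      simp [walk_cons, walkStep, h]
    · refine uprob_eq_zero fun c hc => h ?_
      have h1 : |walk H u (extendBits c) (n + 1)| < H := by rw [hc]; exact hv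
      exact abs_walk_lt_of_le h1 (Nat.zero_le _)

end Surviving

/-! ### Coupling the untimed paths of two walks -/

section PathCoupling

/-- Matching large values of `f` with small ones: Hall's condition for the relation
`f s + f t ≤ 0` only needs to be checked for the sets `{s | j ≤ f s}`. -/
lemma exists_injective_add_nonpos {S : Type} [Finite S] (f : S → ℤ)
    (hf : ∀ j : ℤ, 1 ≤ j → Nat.card {s // j ≤ f s} ≤ Nat.card {s // f s ≤ -j}) :
    ∃ g : S → S, Function.Injective g ∧ ∀ s, f s + f (g s) ≤ 0 := by
  classical
  have := Fintype.ofFinite S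
  simp only [Nat.card_eq_fintype_card, Fintype.card_subtype] at hf
  -- passing to complements turns the hypothesis for `1 - j` into the one for `j`
  have hf' : ∀ j : ℤ, (Finset.univ.filter fun s => j ≤ f s).card ≤
      (Finset.univ.filter fun s => f s ≤ -j).card := by
    intro j
    by_cases hj : 1 ≤ j
    · exact hf j hj
    · have h := hf (1 - j) (by omega)
      have h1 := Finset.card_filter_add_card_filter_not (s := Finset.univ) fun s => j ≤ f s
      have h2 := Finset.card_filter_add_card_filter_not (s := Finset.univ) fun s => f s ≤ -j
      have h3 : (Finset.univ.filter fun s => ¬ j ≤ f s) =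
          Finset.univ.filter fun s => f s ≤ -(1 - j) :=
        Finset.filter_congr fun s _ => by omega
      have h4 : (Finset.univ.filter fun s => ¬ f s ≤ -j) =
          Finset.univ.filter fun s => 1 - j ≤ f s :=
        Finset.filter_congr fun s _ => by omega
      rw [h3] at h1
      rw [h4] at h2
      omega
  obtain ⟨g, hg, hg'⟩ := (Finset.all_card_le_biUnion_card_iff_exists_injective
    fun s => Finset.univ.filter fun t => f s + f t ≤ 0).1 fun A => by
      rcases A.eq_empty_or_nonempty with rfl | hA
      · simp
      obtain ⟨a, ha, hmin⟩ := A.exists_min_image f hA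
      calc A.card ≤ (Finset.univ.filter fun s => f a ≤ f s).card :=
            Finset.card_le_card fun s hs => by simpa using hmin s hs
        _ ≤ (Finset.univ.filter fun s => f s ≤ -f a).card := hf' _
        _ ≤ _ := Finset.card_le_card fun t ht => by
            rw [Finset.mem_biUnion]
            refine ⟨a, ha, ?_⟩
            simp only [Finset.mem_filter, Finset.mem_univ, true_and] at ht ⊢
            omega
  exact ⟨g, hg, fun s => by simpa using hg' s⟩

/-- An injection of `{s | p s}` into its complement that reverses the sign of `f` extends to an
involution of the whole type: exchange `s` with its image, and fix all other points. -/
lemma exists_involutive_of_injOn {S : Type} (p : S → Prop) (f : S → ℤ)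
    (j : S → S) (hj : ∀ s t, p s → p t → j s = j t → s = t) (hp : ∀ s, p s → ¬ p (j s))
    (hf : ∀ s, p s → f (j s) = -f s) :
    ∃ g : S → S, Function.Involutive g ∧ ∀ s, f (g s) = -f s ∨ (g s = s ∧ ¬ p s) := by
  classical
  let g : S → S := fun s =>
    if p s then j s else if h : ∃ t, p t ∧ j t = s then h.choose else s
  have g1 : ∀ s, p s → g s = j s := fun s hs => if_pos hs
  have g2 : ∀ s, p s → g (j s) = s := fun s hs => by
    have h : ∃ t, p t ∧ j t = j s := ⟨s, hs, rfl⟩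
    have : g (j s) = h.choose := by simp only [g, if_neg (hp s hs), dif_pos h]
    rw [this]
    exact hj _ _ h.choose_spec.1 hs h.choose_spec.2
  have g3 : ∀ s, ¬ p s → (¬ ∃ t, p t ∧ j t = s) → g s = s := fun s h1 h2 => by
    simp only [g, if_neg h1, dif_neg h2]
  refine ⟨g, fun s => ?_, fun s => ?_⟩
  · by_cases hs : p s
    · rw [g1 s hs, g2 s hs]
    · by_cases h : ∃ t, p t ∧ j t = s
      · obtain ⟨t, ht, rfl⟩ := h
        rw [g2 t ht, g1 t ht]
      · rw [g3 s hs h, g3 s hs h]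
  · by_cases hs : p s
    · rw [g1 s hs]
      exact Or.inl (hf s hs)
    · by_cases h : ∃ t, p t ∧ j t = s
      · obtain ⟨t, ht, rfl⟩ := h
        rw [g2 t ht, hf t ht, neg_neg]
        exact Or.inl rfl
      · exact Or.inr ⟨g3 s hs h, hs⟩

/-- The minimum of a walk up to time `m`. -/
def walkMin (H z : ℤ) (c : ℕ → Bool) (m : ℕ) : ℤ :=
  (Finset.range (m + 1)).inf' Finset.nonempty_range_add_one (walk H z c)

variable {H z : ℤ} {m T : ℕ}

lemma walkMin_le_iff {c : ℕ → Bool} {v : ℤ} :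
    walkMin H z c m ≤ v ↔ ∃ i ≤ m, walk H z c i ≤ v := by
  rw [walkMin, Finset.inf'_le_iff]
  simp

lemma le_walkMin_iff {c : ℕ → Bool} {v : ℤ} :
    v ≤ walkMin H z c m ↔ ∀ i ≤ m, v ≤ walk H z c i := by
  rw [walkMin, Finset.le_inf'_iff]
  simp

lemma walkMin_le_start {c : ℕ → Bool} : walkMin H z c m ≤ z :=
  walkMin_le_iff.2 ⟨0, Nat.zero_le _, le_rfl⟩

/-- Among the paths absorbed by time `m`, those staying at or above `j` are at most as many as those
descending to `-j`. In `hnum`, the two fractions are the gambler's ruin probabilities of reaching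
`H` before `j - 1` and before `-j`. -/
lemma bitProb_le_walkMin_le (hm : m ≤ T) (hzH : z < H) {α : ℝ}
    (hα : bitProb T (fun c => |walk H z c m| < H) ≤ α)
    (hnum : ∀ j : ℤ, 1 ≤ j → j ≤ z →
      ((z : ℝ) - j + 1) / (H - j + 1) + (z + j) / (H + j) ≤ 1 - α) (j : ℤ) (hj : 1 ≤ j) :
    bitProb T (fun c => H ≤ |walk H z c m| ∧ j ≤ walkMin H z c m) ≤
      bitProb T (fun c => H ≤ |walk H z c m| ∧ walkMin H z c m ≤ -j) := by
  by_cases hjz : j ≤ z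
  · have htop : ∀ c : ℕ → Bool, H ≤ |walk H z c m| → -H < walk H z c m → walk H z c m = H := by
      intro c h1 h2
      have h3 := abs_walk_le (c := c) (show |z| ≤ H by rw [abs_le]; omega) m
      rw [abs_le] at h3
      rw [le_abs] at h1
      omega
    have h1 := bitProb_reach_top_le (b := j - 1) (by omega) (by omega) m T hm z (by omega) hzH.le
    have h2 := bitProb_reach_top_le (b := -j) (by omega) (by omega) m T hm z (by omega) hzH.le
    have h3 : bitProb T (fun c => H ≤ |walk H z c m| ∧ j ≤ walkMin H z c m) ≤
        bitProb T (fun c => walk H z c m = H ∧ ∀ i ≤ m, j - 1 < walk H z c i) :=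
      bitProb_mono fun c ⟨hc1, hc2⟩ => by
        rw [le_walkMin_iff] at hc2
        refine ⟨htop c hc1 ?_, fun i hi => by linarith [hc2 i hi]⟩
        linarith [hc2 m le_rfl]
    have h4 : bitProb T (fun c => H ≤ |walk H z c m| ∧ ¬ walkMin H z c m ≤ -j) ≤
        bitProb T (fun c => walk H z c m = H ∧ ∀ i ≤ m, -j < walk H z c i) :=
      bitProb_mono fun c ⟨hc1, hc2⟩ => by
        have hc3 : ∀ i ≤ m, -j < walk H z c i := fun i hi => by
          by_contra! hc
          exact hc2 (walkMin_le_iff.2 ⟨i, hi, hc⟩)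
        exact ⟨htop c hc1 (by linarith [hc3 m le_rfl]), hc3⟩
    have h5 : bitProb T (fun c => H ≤ |walk H z c m|) =
        bitProb T (fun c => H ≤ |walk H z c m| ∧ walkMin H z c m ≤ -j) +
        bitProb T (fun c => H ≤ |walk H z c m| ∧ ¬ walkMin H z c m ≤ -j) := uprob_split _ _
    have h6 : bitProb T (fun c => H ≤ |walk H z c m|) =
        1 - bitProb T (fun c => |walk H z c m| < H) := by
      rw [bitProb, bitProb, ← uprob_not]
      exact uprob_congr fun c => not_lt.symm
    have hjR : (1 : ℝ) ≤ j := by exact_mod_cast hj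
    have hjH : (j : ℝ) < H := by exact_mod_cast (by omega : j < H)
    have h7 := hnum j hj hjz
    have h8 : bitProb T (fun c => walk H z c m = H ∧ ∀ i ≤ m, j - 1 < walk H z c i) ≤
        ((z : ℝ) - j + 1) / (H - j + 1) := by
      rw [le_div_iff₀ (by linarith)]
      push_cast at h1
      linarith
    have h9 : bitProb T (fun c => walk H z c m = H ∧ ∀ i ≤ m, -j < walk H z c i) ≤
        ((z : ℝ) + j) / (H + j) := by
      rw [le_div_iff₀ (by linarith)]
      push_cast at h2
      linarith
    linarith
  · rw [bitProb, uprob_eq_zero fun c hc => hjz (hc.2.trans walkMin_le_start)]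
    exact bitProb_nonneg _

lemma card_subtype_le_of_uprob_le {Ω : Type} [Finite Ω] [Nonempty Ω] {p q r : Ω → Prop}
    (h : uprob (fun ω => p ω ∧ q ω) ≤ uprob fun ω => p ω ∧ r ω) :
    Nat.card {s : {ω // p ω} // q s.1} ≤ Nat.card {s : {ω // p ω} // r s.1} := by
  have hpos : (0 : ℝ) < Nat.card Ω := by exact_mod_cast Nat.card_pos
  rw [uprob, uprob, div_le_div_iff_of_pos_right hpos, Nat.cast_le] at h
  rw [Nat.card_congr (Equiv.subtypeSubtypeEquivSubtypeInter p q),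
    Nat.card_congr (Equiv.subtypeSubtypeEquivSubtypeInter p r)]
  exact h

/-- Matching of the paths absorbed by time `m`: the path of `c` and the reflected path of `g c` have
overlapping ranges. -/
lemma exists_coupling_absorbed (hm : m ≤ T) (hzH : z < H) {α : ℝ}
    (hα : bitProb T (fun c => |walk H z c m| < H) ≤ α)
    (hnum : ∀ j : ℤ, 1 ≤ j → j ≤ z →
      ((z : ℝ) - j + 1) / (H - j + 1) + (z + j) / (H + j) ≤ 1 - α) :
    ∃ g : {c : Fin T → Bool // H ≤ |walk H z (extendBits c) m|} →
        {c : Fin T → Bool // H ≤ |walk H z (extendBits c) m|}, Function.Injective g ∧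
      ∀ c, walkMin H z (extendBits c.1) m + walkMin H z (extendBits (g c).1) m ≤ 0 := by
  have hf : Finite {c : Fin T → Bool // H ≤ |walk H z (extendBits c) m|} := Subtype.finite
  refine exists_injective_add_nonpos (S := {c : Fin T → Bool // H ≤ |walk H z (extendBits c) m|})
    (fun c => walkMin H z (extendBits c.1) m) fun j hj => ?_
  exact card_subtype_le_of_uprob_le (p := fun c => H ≤ |walk H z (extendBits c) m|)
    (q := fun c => j ≤ walkMin H z (extendBits c) m)
    (r := fun c => walkMin H z (extendBits c) m ≤ -j) (bitProb_le_walkMin_le hm hzH hα hnum j hj)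

/-- Matching of the paths alive at time `m`: the path of `c` and the reflected path of `g c` are at
the same point at the same time. A path that visits the origin is on its own reflection there; the
others are exchanged with paths that end at the opposite point. -/
lemma exists_coupling_alive (hm : m ≤ T) (hz0 : 0 < z) (hzH : z < H)
    (hpos : ∀ v, 0 < v → v < H → posProb H m z v ≤ aliveProb H m z (-v)) :
    ∃ g : (Fin T → Bool) → Fin T → Bool, Function.Injective g ∧
      ∀ c, |walk H z (extendBits c) m| < H → |walk H z (extendBits (g c)) m| < H ∧
        ∃ i ≤ m, |walk H z (extendBits c) i| < H ∧
          walk H z (extendBits c) i + walk H z (extendBits (g c)) i = 0 := by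
  set W : (Fin T → Bool) → ℤ := fun c => walk H z (extendBits c) m with hW
  -- the paths that stay positive
  let p : (Fin T → Bool) → Prop := fun c => W c < H ∧ ∀ i ≤ m, 0 < walk H z (extendBits c) i
  have hemb : ∀ v : ℤ, ∃ φ : (Fin T → Bool) → Fin T → Bool,
      ∀ c, p c → W c = v → W (φ c) = -v ∧ ∀ c', p c' → W c' = v → φ c = φ c' → c = c' := by
    intro v
    by_cases hv : 0 < v ∧ v < H
    · have h := hpos v hv.1 hv.2
      rw [← bitProb_eq_posProb hv.1 hv.2 m T hm,
        ← bitProb_eq_aliveProb (by rw [abs_neg, abs_lt]; omega) m T hm] at h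
      have hcard : (0 : ℝ) < Nat.card (Fin T → Bool) := by exact_mod_cast Nat.card_pos
      simp only [bitProb, uprob] at h
      rw [div_le_div_iff_of_pos_right hcard, Nat.cast_le] at h
      classical
      rw [Nat.card_eq_fintype_card, Nat.card_eq_fintype_card] at h
      obtain ⟨φ⟩ := Function.Embedding.nonempty_of_card_le h
      let ψ : (Fin T → Bool) → Fin T → Bool := fun c =>
        if hc : W c = v ∧ ∀ i ≤ m, 0 < walk H z (extendBits c) i then φ ⟨c, hc⟩ else c
      have hψ : ∀ c (hc : W c = v ∧ ∀ i ≤ m, 0 < walk H z (extendBits c) i), ψ c = φ ⟨c, hc⟩ :=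
        fun c hc => dif_pos hc
      refine ⟨ψ, fun c hc hcv => ?_⟩
      rw [hψ c ⟨hcv, hc.2⟩]
      refine ⟨(φ ⟨c, hcv, hc.2⟩).2, fun c' hc' hcv' he => ?_⟩
      rw [hψ c' ⟨hcv', hc'.2⟩] at he
      exact congrArg Subtype.val (φ.injective (Subtype.ext he))
    · exact ⟨id, fun c hc hcv => absurd ⟨by rw [← hcv]; exact hc.2 m le_rfl, hcv ▸ hc.1⟩ hv⟩
  choose φ hφ using hemb
  obtain ⟨g, hg, hg'⟩ := exists_involutive_of_injOn p W (fun c => φ (W c) c)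
    (fun s t hs ht h => by
      have h1 := (hφ _ s hs rfl).1
      have h2 := (hφ _ t ht rfl).1
      have hst : W s = W t := by
        have := congrArg W h
        simp only [h1, h2] at this
        omega
      exact (hφ _ s hs rfl).2 t ht hst.symm (by rw [hst] at h ⊢; exact h))
    (fun s hs h => by
      have h1 := (hφ _ s hs rfl).1
      have h2 := h.2 m le_rfl
      have h3 := hs.2 m le_rfl
      have h4 : W (φ (W s) s) = walk H z (extendBits (φ (W s) s)) m := rfl
      have h5 : W s = walk H z (extendBits s) m := rfl
      omega)
    (fun s hs => (hφ _ s hs rfl).1)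
  refine ⟨g, hg.injective, fun c hc => ?_⟩
  rcases hg' c with h | ⟨h, hnp⟩
  · have h' : walk H z (extendBits (g c)) m = -walk H z (extendBits c) m := h
    refine ⟨?_, m, le_rfl, hc, ?_⟩
    · rw [h', abs_neg]; exact hc
    · rw [h']; ring
  · rw [h]
    refine ⟨hc, ?_⟩
    have : ∃ i ≤ m, walk H z (extendBits c) i ≤ 0 := by
      by_contra! hcon
      exact hnp ⟨(abs_lt.1 hc).2, hcon⟩
    obtain ⟨i, hi, hle⟩ := this
    obtain ⟨i', hi', h0⟩ := exists_walk_eq hz0.le hle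
    refine ⟨i', hi'.trans hi, ?_, ?_⟩
    · rw [h0, abs_zero]; omega
    · rw [h0]; rfl

/-- The walks from `z` and `-z` can be coupled such that they visit a common point, up to a shift
of time; the shift is needed only if both are absorbed by time `m`. -/
theorem exists_path_coupling (hm : m ≤ T) (hz0 : 0 < z) (hzH : z < H) {α : ℝ}
    (hα : bitProb T (fun c => |walk H z c m| < H) ≤ α)
    (hnum : ∀ j : ℤ, 1 ≤ j → j ≤ z →
      ((z : ℝ) - j + 1) / (H - j + 1) + (z + j) / (H + j) ≤ 1 - α)
    (hpos : ∀ v, 0 < v → v < H → posProb H m z v ≤ aliveProb H m z (-v)) :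
    ∃ g : (Fin T → Bool) → Fin T → Bool, Function.Injective g ∧ ∀ c, ∃ i ≤ m, ∃ i' ≤ m,
      |walk H z (extendBits c) i| < H ∧
      walk H z (extendBits c) i = walk H (-z) (extendBits (g c)) i' ∧
      (i = i' ∨ (H ≤ |walk H z (extendBits c) m| ∧ H ≤ |walk H (-z) (extendBits (g c)) m|)) := by
  classical
  obtain ⟨g₁, hg₁, h₁⟩ := exists_coupling_absorbed hm hzH hα hnum
  obtain ⟨g₂, hg₂, h₂⟩ := exists_coupling_alive hm hz0 hzH hpos
  let flip : (Fin T → Bool) → Fin T → Bool := fun c i => !c i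
  have hflip : Function.Injective flip := fun c c' h => funext fun i => by
    simpa [flip] using congrFun h i
  have hwalk : ∀ c : Fin T → Bool, ∀ i ≤ m,
      walk H (-z) (extendBits (flip c)) i = -walk H z (extendBits c) i := fun c i hi => by
    rw [← walk_neg]
    refine walk_congr fun k hk => ?_
    have : k < T := by omega
    simp [extendBits, this, flip]
  let g : (Fin T → Bool) → Fin T → Bool := fun c =>
    if h : H ≤ |walk H z (extendBits c) m| then (g₁ ⟨c, h⟩).1 else g₂ c
  have ga : ∀ c (h : H ≤ |walk H z (extendBits c) m|), g c = (g₁ ⟨c, h⟩).1 := fun c h => dif_pos h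
  have gb : ∀ c, ¬ H ≤ |walk H z (extendBits c) m| → g c = g₂ c := fun c h => dif_neg h
  have hgstay : ∀ c, H ≤ |walk H z (extendBits (g c)) m| ↔ H ≤ |walk H z (extendBits c) m| := by
    intro c
    by_cases h : H ≤ |walk H z (extendBits c) m|
    · rw [ga c h]
      exact iff_of_true (g₁ ⟨c, h⟩).2 h
    · rw [gb c h]
      exact iff_of_false (not_le.2 (h₂ c (not_le.1 h)).1) h
  refine ⟨fun c => flip (g c), hflip.comp fun c c' hcc => ?_, fun c => ?_⟩
  · have hiff := (hgstay c).symm.trans ((congrArg (fun b => H ≤ |walk H z (extendBits b) m|)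
      hcc).to_iff.trans (hgstay c'))
    by_cases h : H ≤ |walk H z (extendBits c) m|
    · rw [ga c h, ga c' (hiff.1 h)] at hcc
      exact congrArg Subtype.val (hg₁ (Subtype.ext hcc))
    · rw [gb c h, gb c' fun h' => h (hiff.2 h')] at hcc
      exact hg₂ hcc
  · by_cases h : H ≤ |walk H z (extendBits c) m|
    · have hsum := h₁ ⟨c, h⟩
      rw [← ga c h] at hsum
      have hs1 : walkMin H z (extendBits c) m ≤ z := walkMin_le_start
      have hs2 : walkMin H z (extendBits (g c)) m ≤ z := walkMin_le_start
      -- the lowest point of the upper walk that lies in the range of the lower one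
      obtain ⟨v, hv⟩ : ∃ v, v = max (walkMin H z (extendBits c) m) (-z) := ⟨_, rfl⟩
      obtain ⟨i₀, hi₀, hle⟩ := walkMin_le_iff.1 (show walkMin H z (extendBits c) m ≤ v by omega)
      obtain ⟨k₀, hk₀, hle'⟩ := walkMin_le_iff.1 (show walkMin H z (extendBits (g c)) m ≤ -v by
        simp only at hsum
        omega)
      obtain ⟨i, hi, hei⟩ := exists_walk_eq (by omega) hle
      obtain ⟨k, hk, hek⟩ := exists_walk_eq (by omega) hle'
      refine ⟨i, hi.trans hi₀, k, hk.trans hk₀, ?_, ?_, Or.inr ⟨h, ?_⟩⟩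
      · rw [hei, abs_lt]; omega
      · rw [hwalk _ _ (hk.trans hk₀), hek, hei, neg_neg]
      · rw [hwalk _ _ le_rfl, abs_neg]
        exact (hgstay c).2 h
    · obtain ⟨-, i, hi, hlt, h0⟩ := h₂ c (not_le.1 h)
      refine ⟨i, hi, i, hi, hlt, ?_, Or.inl rfl⟩
      rw [hwalk _ _ hi, gb c h]
      omega

end PathCoupling

/-! ### The walk with a random start, and its coupling -/

section DelayedWalk

/-- States of the delayed walk: waiting at `z` until time `g`, walking (or absorbed at an end) at
`v`, or discarded. -/
inductive DelayedState
  | wait (z : ℤ) (g : ℕ)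
  | pos (v : ℤ)
  | discarded

open DelayedState

/-- The update rule at time `t`. The first step draws the delay `g`; the walk is started at time
`g + 2`. A walk that is absorbed outside the time window `[lo, hi)` is discarded. -/
def delayedStep (H : ℤ) (lo hi : ℕ) {L : ℕ} (t : ℕ) : DelayedState → Fin L × Bool → DelayedState
  | wait z g, a => if t = 0 then wait z a.1 else if t ≤ g then wait z g else pos z
  | pos v, a => if |walkStep H v a.2| < H ∨ H ≤ |v| ∨ (lo ≤ t + 1 ∧ t + 1 < hi) then
      pos (walkStep H v a.2) else discarded
  | discarded, _ => discarded

/-- Rotate the bits cyclically by `k`. -/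
def rotateBits {T : ℕ} [NeZero T] (k : ℕ) (b : Fin T → Bool) (i : Fin T) : Bool :=
  b (i + Fin.ofNat T k)

lemma rotateBits_injective {T : ℕ} [NeZero T] (k : ℕ) :
    Function.Injective (rotateBits k : (Fin T → Bool) → Fin T → Bool) := fun b b' h => by
  funext i
  simpa [rotateBits] using congrFun h (i - Fin.ofNat T k)

lemma extendBits_rotateBits {T : ℕ} [NeZero T] {k i : ℕ} (h : k + i < T) (b : Fin T → Bool) :
    extendBits (rotateBits k b) i = extendBits b (k + i) := by
  have hi : i < T := by omega
  simp only [extendBits, h, hi, dite_true, rotateBits]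
  congr 1
  apply Fin.ext
  rw [Fin.val_add, Fin.val_ofNat, Nat.mod_eq_of_lt (show k < T by omega), Nat.add_comm,
    Nat.mod_eq_of_lt h]

variable {H z : ℤ} {L m lo hi : ℕ}

/-- The delay read off from the noise. -/
def delay (ω : Fin (L + m + 1) → Fin L × Bool) : ℕ := (ω 0).1

/-- The bits that drive the walk, counted from its start at time `delay ω + 2`. The rotation is
cyclic in order to be a bijection; the bits beyond the time horizon are never read. -/
def walkBits (ω : Fin (L + m + 1) → Fin L × Bool) : Fin (L + m + 1) → Bool :=
  rotateBits (delay ω + 2) fun i => (ω i).2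

lemma delay_lt (ω : Fin (L + m + 1) → Fin L × Bool) : delay ω < L := (ω 0).1.2

/-- The delay `g` is drawn at time `0`, and the state is `wait z g` from time `1` to `g + 1`. -/
lemma delayedTraj_start (ω : Fin (L + m + 1) → Fin L × Bool) :
    noiseTraj (delayedStep H lo hi) (wait z 0) ω (delay ω + 2) = pos z := by
  have hg := delay_lt ω
  have hwait : ∀ n ≤ delay ω,
      noiseTraj (delayedStep H lo hi) (wait z 0) ω (n + 1) = wait z (delay ω) := by
    intro n
    induction n with
    | zero =>
      intro _
      rw [noiseTraj_succ _ _ _ (by omega)]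
      rfl
    | succ n ih =>
      intro hn
      rw [noiseTraj_succ _ _ _ (by omega), ih (by omega)]
      simp [delayedStep, hn]
  rw [noiseTraj_succ _ _ _ (by omega), hwait _ le_rfl]
  simp [delayedStep]

lemma delayedTraj_step (ω : Fin (L + m + 1) → Fin L × Bool) {n : ℕ}
    (hn : delay ω + 2 + (n + 1) ≤ L + m + 1) :
    ∃ i : Fin L, noiseTraj (delayedStep H lo hi) (wait z 0) ω (delay ω + 2 + (n + 1)) =
      delayedStep H lo hi (delay ω + 2 + n)
        (noiseTraj (delayedStep H lo hi) (wait z 0) ω (delay ω + 2 + n))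
        (i, extendBits (walkBits ω) n) := by
  have h : delay ω + 2 + n < L + m + 1 := by omega
  refine ⟨(ω ⟨_, h⟩).1, ?_⟩
  rw [walkBits, extendBits_rotateBits h, ← Nat.add_assoc, noiseTraj_succ _ _ _ h, extendBits,
    dif_pos h]

lemma delayedTraj_alive (ω : Fin (L + m + 1) → Fin L × Bool) {n : ℕ}
    (hn : delay ω + 2 + n ≤ L + m + 1) (h : |walk H z (extendBits (walkBits ω)) n| < H) :
    noiseTraj (delayedStep H lo hi) (wait z 0) ω (delay ω + 2 + n) =
      pos (walk H z (extendBits (walkBits ω)) n) := by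
  induction n with
  | zero => exact delayedTraj_start ω
  | succ n ih =>
    obtain ⟨i, hs⟩ := delayedTraj_step (H := H) (z := z) (lo := lo) (hi := hi) ω hn
    rw [hs, ih (by omega) (abs_walk_lt_of_le h (Nat.le_succ n)), delayedStep]
    rw [walk] at h ⊢
    rw [if_pos (Or.inl h)]

lemma delayedTraj_eq_or (ω : Fin (L + m + 1) → Fin L × Bool) {n : ℕ}
    (hn : delay ω + 2 + n ≤ L + m + 1) :
    noiseTraj (delayedStep H lo hi) (wait z 0) ω (delay ω + 2 + n) =
        pos (walk H z (extendBits (walkBits ω)) n) ∨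
      noiseTraj (delayedStep H lo hi) (wait z 0) ω (delay ω + 2 + n) = discarded := by
  induction n with
  | zero => exact Or.inl (delayedTraj_start ω)
  | succ n ih =>
    obtain ⟨i, hs⟩ := delayedTraj_step (H := H) (z := z) (lo := lo) (hi := hi) ω hn
    rw [hs, walk]
    rcases ih (by omega) with h | h
    · rw [h, delayedStep]
      split_ifs
      · exact Or.inl rfl
      · exact Or.inr rfl
    · rw [h]
      exact Or.inr rfl

/-- A delay that is not extreme puts absorption by step `m` inside the window. -/
lemma delayedTraj_kept (ω : Fin (L + m + 1) → Fin L × Bool) {n : ℕ} (hn : n ≤ m)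
    (hlo : lo ≤ delay ω + 2) (hhi : delay ω + 2 + m < hi) :
    noiseTraj (delayedStep H lo hi) (wait z 0) ω (delay ω + 2 + n) =
      pos (walk H z (extendBits (walkBits ω)) n) := by
  have hg := delay_lt ω
  induction n with
  | zero => exact delayedTraj_start ω
  | succ n ih =>
    obtain ⟨i, hs⟩ := delayedTraj_step (H := H) (z := z) (lo := lo) (hi := hi) ω (n := n) (by omega)
    rw [hs, ih (by omega), delayedStep, if_pos (Or.inr (Or.inr (by omega))), walk]

/-- An extreme delay puts absorption by step `m` outside the window. -/
lemma delayedTraj_discarded (ω : Fin (L + m + 1) → Fin L × Bool) (hz : |z| < H) {n : ℕ}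
    (hn : n ≤ m) (hbad : delay ω + 2 + m < lo ∨ hi ≤ delay ω + 2)
    (h : H ≤ |walk H z (extendBits (walkBits ω)) n|) :
    noiseTraj (delayedStep H lo hi) (wait z 0) ω (delay ω + 2 + n) = discarded := by
  have hg := delay_lt ω
  induction n with
  | zero => exact absurd hz (not_lt.2 h)
  | succ n ih =>
    obtain ⟨i, hs⟩ := delayedTraj_step (H := H) (z := z) (lo := lo) (hi := hi) ω (n := n) (by omega)
    rw [hs]
    by_cases h' : |walk H z (extendBits (walkBits ω)) n| < H
    · rw [delayedTraj_alive ω (by omega) h', delayedStep, if_neg]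
      rw [walk] at h
      rintro (h1 | h1 | h1)
      · exact absurd h (not_le.2 h1)
      · exact absurd h' (not_lt.2 h1)
      · omega
    · rw [ih (by omega) (not_lt.1 h')]
      rfl

lemma delayedTraj_absorbed (ω : Fin (L + m + 1) → Fin L × Bool) {n n' : ℕ}
    (hn' : delay ω + 2 + n' ≤ L + m + 1) (hnn : n ≤ n')
    (h : H ≤ |walk H z (extendBits (walkBits ω)) n|) :
    noiseTraj (delayedStep H lo hi) (wait z 0) ω (delay ω + 2 + n') =
      noiseTraj (delayedStep H lo hi) (wait z 0) ω (delay ω + 2 + n) := by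
  induction n', hnn using Nat.le_induction with
  | base => rfl
  | succ k hk ih =>
    obtain ⟨i, hs⟩ := delayedTraj_step (H := H) (z := z) (lo := lo) (hi := hi) ω hn'
    rw [hs, ih (by omega)]
    rcases delayedTraj_eq_or (H := H) (z := z) (lo := lo) (hi := hi) ω (n := n) (by omega)
      with h' | h'
    · rw [h', delayedStep, if_pos (Or.inr (Or.inl h)), walkStep, if_neg (not_lt.2 h)]
    · rw [h']
      rfl

lemma delayedTraj_final (ω : Fin (L + m + 1) → Fin L × Bool)
    (h : H ≤ |walk H z (extendBits (walkBits ω)) m|) :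
    noiseTraj (delayedStep H lo hi) (wait z 0) ω (L + m + 1) =
      noiseTraj (delayedStep H lo hi) (wait z 0) ω (delay ω + 2 + m) := by
  have hg := delay_lt ω
  have := delayedTraj_absorbed (lo := lo) (hi := hi) ω (n' := L + m + 1 - (delay ω + 2))
    (by omega) (by omega) h
  rwa [show delay ω + 2 + (L + m + 1 - (delay ω + 2)) = L + m + 1 by omega] at this

/-- The noise with prescribed walk bits and delay, other coordinates being taken from `ω`. -/
def replaceNoise (ω : Fin (L + m + 1) → Fin L × Bool) (g : Fin L) (c : Fin (L + m + 1) → Bool) :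
    Fin (L + m + 1) → Fin L × Bool :=
  fun i => (if i = 0 then g else (ω i).1, c (i - Fin.ofNat _ (g + 2)))

lemma delay_replaceNoise (ω : Fin (L + m + 1) → Fin L × Bool) (g : Fin L)
    (c : Fin (L + m + 1) → Bool) : delay (replaceNoise ω g c) = g := by
  simp [delay, replaceNoise]

lemma walkBits_replaceNoise (ω : Fin (L + m + 1) → Fin L × Bool) (g : Fin L)
    (c : Fin (L + m + 1) → Bool) : walkBits (replaceNoise ω g c) = c := by
  funext i
  rw [walkBits, delay_replaceNoise]
  simp [rotateBits, replaceNoise]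

lemma noise_ext {ω ω' : Fin (L + m + 1) → Fin L × Bool} (h1 : ∀ i, (ω i).1 = (ω' i).1)
    (h2 : walkBits ω = walkBits ω') : ω = ω' := by
  have hd : delay ω = delay ω' := congrArg Fin.val (h1 0)
  rw [walkBits, walkBits, hd] at h2
  have h3 := rotateBits_injective _ h2
  funext i
  exact Prod.ext (h1 i) (congrFun h3 i)

/-- A cyclic shift of `g` by `i - i'` modulo `L` either is an honest shift, or wraps around one of
the ends of `[0, L)`. -/
lemma cyclic_shift_cases {g i i' L m : ℕ} (hg : g < L) (hi : i ≤ m) (hi' : i' ≤ m) (hm : m < L) :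
    (g + i + (L - i')) % L + i' = g + i ∨
      (i ≠ i' ∧ g < m ∧ L - m ≤ (g + i + (L - i')) % L) ∨
      (i ≠ i' ∧ (g + i + (L - i')) % L < m ∧ L - m ≤ g) := by
  by_cases h1 : g + i + (L - i') < L
  · rw [Nat.mod_eq_of_lt h1]
    omega
  · rw [Nat.mod_eq_sub_mod (by omega)]
    by_cases h2 : g + i + (L - i') - L < L
    · rw [Nat.mod_eq_of_lt h2]
      omega
    · rw [Nat.mod_eq_sub_mod (by omega), Nat.mod_eq_of_lt (by omega)]
      omega

/-- A shift of time in the path coupling is undone by a cyclic shift of the uniform delay. If that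
shift wraps around, then both delays are extreme, and both walks are discarded. -/
theorem exists_noise_coupling (hL : m < L) (hzH : |z| < H)
    (π : (Fin (L + m + 1) → Bool) → Fin (L + m + 1) → Bool) (hπ : Function.Injective π)
    (hmeet : ∀ c, ∃ i ≤ m, ∃ i' ≤ m, |walk H z (extendBits c) i| < H ∧
      walk H z (extendBits c) i = walk H (-z) (extendBits (π c)) i' ∧
      (i = i' ∨ (H ≤ |walk H z (extendBits c) m| ∧ H ≤ |walk H (-z) (extendBits (π c)) m|))) :
    ∃ Φ : (Fin (L + m + 1) → Fin L × Bool) → Fin (L + m + 1) → Fin L × Bool,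
      Function.Injective Φ ∧ ∀ ω, ∃ n,
        noiseTraj (delayedStep H (2 * m + 2) (L - m)) (wait z 0) ω n =
          noiseTraj (delayedStep H (2 * m + 2) (L - m)) (wait (-z) 0) (Φ ω) n := by
  choose i hi i' hi' hlt heq hor using hmeet
  let g' : (Fin (L + m + 1) → Fin L × Bool) → Fin L := fun ω =>
    ⟨(delay ω + i (walkBits ω) + (L - i' (walkBits ω))) % L, Nat.mod_lt _ (by omega)⟩
  refine ⟨fun ω => replaceNoise ω (g' ω) (π (walkBits ω)), fun ω ω' h => ?_, fun ω => ?_⟩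
  · simp only at h
    have hb := congrArg walkBits h
    rw [walkBits_replaceNoise, walkBits_replaceNoise] at hb
    have hb := hπ hb
    have hd := congrArg delay h
    rw [delay_replaceNoise, delay_replaceNoise] at hd
    simp only [g', hb, Nat.add_assoc] at hd
    have hd := Nat.ModEq.add_right_cancel' _ hd
    have hd : delay ω = delay ω' := by
      rwa [Nat.ModEq, Nat.mod_eq_of_lt (delay_lt ω), Nat.mod_eq_of_lt (delay_lt ω')] at hd
    refine noise_ext (fun j => ?_) hb
    by_cases hj : j = 0
    · subst hj
      exact Fin.ext hd
    · have := congrArg Prod.fst (congrFun h j)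
      simpa [replaceNoise, hj] using this
  · have hg := delay_lt ω
    have hd : delay (replaceNoise ω (g' ω) (π (walkBits ω))) = g' ω := delay_replaceNoise _ _ _
    have hb : walkBits (replaceNoise ω (g' ω) (π (walkBits ω))) = π (walkBits ω) :=
      walkBits_replaceNoise _ _ _
    have hg'v : (g' ω : ℕ) = (delay ω + i (walkBits ω) + (L - i' (walkBits ω))) % L := rfl
    have hg'L := (g' ω).2
    have hcases := cyclic_shift_cases hg (hi (walkBits ω)) (hi' (walkBits ω)) hL
    rw [← hg'v] at hcases
    have hi1 := hi (walkBits ω)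
    have hi2 := hi' (walkBits ω)
    change ∃ n, _ = noiseTraj _ _ (replaceNoise ω (g' ω) (π (walkBits ω))) n
    generalize replaceNoise ω (g' ω) (π (walkBits ω)) = ω' at hd hb ⊢
    -- if the shift wraps around, both walks have been absorbed outside the window
    have wrap : i (walkBits ω) ≠ i' (walkBits ω) →
        (delay ω + 2 + m < 2 * m + 2 ∨ L - m ≤ delay ω + 2) →
        (delay ω' + 2 + m < 2 * m + 2 ∨ L - m ≤ delay ω' + 2) →
        ∃ n, noiseTraj (delayedStep H (2 * m + 2) (L - m)) (wait z 0) ω n =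
          noiseTraj (delayedStep H (2 * m + 2) (L - m)) (wait (-z) 0) ω' n := by
      intro hne h1 h2
      obtain ⟨ha, hb'⟩ := (hor (walkBits ω)).resolve_left hne
      rw [← hb] at hb'
      refine ⟨L + m + 1, ?_⟩
      rw [delayedTraj_final ω ha, delayedTraj_final ω' hb',
        delayedTraj_discarded ω hzH le_rfl h1 ha,
        delayedTraj_discarded ω' (by rwa [abs_neg]) le_rfl h2 hb']
    rcases hcases with h | ⟨hne, h1, h2⟩ | ⟨hne, h1, h2⟩
    · refine ⟨delay ω + 2 + i (walkBits ω), ?_⟩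
      rw [delayedTraj_alive ω (by omega) (hlt _), heq, ← hb]
      have hlt' := hlt (walkBits ω)
      rw [heq, ← hb] at hlt'
      rw [← delayedTraj_alive ω' (by omega) hlt', show delay ω' + 2 + i' (walkBits ω) =
        delay ω + 2 + i (walkBits ω) by omega]
    · exact wrap hne (Or.inl (by omega)) (Or.inr (by omega))
    · exact wrap hne (Or.inr (by omega)) (Or.inl (by omega))

/-- The states that occur when the walk is started in `[-H, H]` and the delay is below `L`. -/
def DelayedState.Bounded (H : ℤ) (L : ℕ) : DelayedState → Prop
  | wait z g => |z| ≤ H ∧ g < L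
  | pos v => |v| ≤ H
  | discarded => True

lemma finite_bounded (H : ℤ) (L : ℕ) : {q : DelayedState | q.Bounded H L}.Finite := by
  refine Set.Finite.subset ((((Set.finite_Icc (-H) H).prod (Set.finite_Iio L)).image
    fun p => wait p.1 p.2).union (((Set.finite_Icc (-H) H).image pos).union
      (Set.finite_singleton discarded))) ?_
  rintro (⟨z, g⟩ | v | _) h
  · exact Or.inl ⟨(z, g), ⟨abs_le.1 h.1, h.2⟩, rfl⟩
  · exact Or.inr (Or.inl ⟨v, abs_le.1 h, rfl⟩)
  · exact Or.inr (Or.inr rfl)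

lemma bounded_delayedStep {t : ℕ} {q : DelayedState} (hq : q.Bounded H L) (a : Fin L × Bool) :
    (delayedStep H lo hi t q a).Bounded H L := by
  rcases q with ⟨v, g⟩ | v | _
  · simp only [delayedStep]
    split_ifs
    · exact ⟨hq.1, a.1.2⟩
    · exact hq
    · exact hq.1
  · simp only [delayedStep]
    split_ifs
    · exact abs_walkStep_le hq _
    · trivial
  · trivial

/-- The delay and the walk bits are independent and uniform. -/
lemma uprob_delay_walkBits (hL : 0 < L) (p : ℕ → Prop) (q : (ℕ → Bool) → Prop) :
    uprob (fun ω : Fin (L + m + 1) → Fin L × Bool => p (delay ω) ∧ q (extendBits (walkBits ω))) =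
      uprob (fun g : Fin L => p g) * bitProb (L + m + 1) q := by
  have : Nonempty (Fin L) := ⟨⟨0, hL⟩⟩
  let e : (Fin (L + m + 1) → Fin L × Bool) →
      (Fin (L + m + 1) → Fin L) × (Fin (L + m + 1) → Bool) :=
    fun ω => (fun i => (ω i).1, walkBits ω)
  have he : Function.Bijective e := by
    refine (Nat.bijective_iff_injective_and_card e).2 ⟨fun ω ω' h => ?_, ?_⟩
    · exact noise_ext (fun i => congrFun (congrArg Prod.fst h) i) (congrArg Prod.snd h)
    · exact Nat.card_congr (Equiv.arrowProdEquivProdArrow _ _ _)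
  have h1 := uprob_past_and_coord (N := Fin L) (0 : Fin (L + m + 1)) (fun _ => True)
    (fun g => p g) fun _ _ _ _ => trivial
  have h0 : uprob (fun _ : Fin (L + m + 1) → Fin L => True) = 1 := uprob_eq_one (by simp)
  rw [h0, one_mul] at h1
  simp only [true_and] at h1
  rw [bitProb, ← h1, ← uprob_prod, ← uprob_comp_bijective he]
  rfl

lemma bitProb_top_le (hzH : |z| ≤ H) (hH : 0 < H) {n T : ℕ} (hn : n ≤ T) :
    2 * H * bitProb T (fun c => walk H z c n = H) ≤ z + H := by
  rw [abs_le] at hzH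
  have h := bitProb_reach_top_le (b := -H) le_rfl (by omega) n T hn z hzH.1 hzH.2
  have h1 : bitProb T (fun c => walk H z c n = H) ≤
      bitProb T (fun c => walk H z c n = H ∧ ∀ i ≤ n, -H < walk H z c i) :=
    bitProb_mono fun c hc => ⟨hc, fun i hi => by
      by_contra! h'
      rw [walk_of_absorbed (by rw [le_abs]; omega) hi] at hc
      omega⟩
  have hHR : (0 : ℝ) < H := by exact_mod_cast hH
  have h2 := mul_le_mul_of_nonneg_left h1 hHR.le
  push_cast at h
  linarith

/-- By reflection, the probability of absorption at `-H` is bounded by `bitProb_top_le`; what remains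
is absorption at `H` or survival. -/
lemma le_bitProb_top (hzH : |z| ≤ H) (hH : 0 < H) {T : ℕ} (hm : m ≤ T) :
    z + H ≤ 2 * H * (bitProb T (fun c => walk H z c m = H) +
      bitProb T (fun c => |walk H z c m| < H)) := by
  have h1 : bitProb T (fun c => walk H z c m = -H) = bitProb T (fun c => walk H (-z) c m = H) := by
    have hbij : Function.Bijective fun (c : Fin T → Bool) i => !c i :=
      Function.Involutive.bijective fun c => by simp
    rw [bitProb, bitProb, ← uprob_comp_bijective hbij fun c => walk H (-z) (extendBits c) m = H]
    refine uprob_congr fun c => ?_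
    have : walk H (-z) (extendBits fun i => !c i) m = -walk H z (extendBits c) m := by
      rw [← walk_neg]
      refine walk_congr fun k hk => ?_
      have : k < T := by omega
      simp [extendBits, this]
    rw [this]
    omega
  have h2 := bitProb_top_le (z := -z) (by rwa [abs_neg]) hH hm
  have h3 : bitProb T (fun c => ¬ |walk H z c m| < H) ≤
      bitProb T (fun c => walk H z c m = H) + bitProb T (fun c => walk H z c m = -H) := by
    rw [bitProb, uprob_split _ fun c : Fin T → Bool => walk H z (extendBits c) m = H]
    refine add_le_add (uprob_mono fun c hc => hc.2) (uprob_mono fun c hc => ?_)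
    have h3 := abs_walk_le (c := extendBits c) hzH m
    have h4 := not_lt.1 hc.1
    rw [abs_le] at h3
    rw [le_abs] at h4
    have := hc.2
    omega
  have h4 : bitProb T (fun c => ¬ |walk H z c m| < H) =
      1 - bitProb T (fun c => |walk H z c m| < H) := uprob_not _
  have hHR : (0 : ℝ) < H := by exact_mod_cast hH
  rw [h4, h1] at h3
  have h5 := mul_le_mul_of_nonneg_left h3 (by positivity : (0 : ℝ) ≤ 2 * H)
  push_cast at h2
  linarith

/-- The chain of the delayed walk, in terms of the parameters of the path coupling. -/
theorem exists_chain_of_path_coupling (hL : m < L) (hzH : |z| < H)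
    (π : (Fin (L + m + 1) → Bool) → Fin (L + m + 1) → Bool) (hπ : Function.Injective π)
    (hmeet : ∀ c, ∃ i ≤ m, ∃ i' ≤ m, |walk H z (extendBits c) i| < H ∧
      walk H z (extendBits c) i = walk H (-z) (extendBits (π c)) i' ∧
      (i = i' ∨ (H ≤ |walk H z (extendBits c) m| ∧ H ≤ |walk H (-z) (extendBits (π c)) m|))) :
    ∃ (S : Type) (_ : Fintype S) (_ : DecidableEq S) (P : Matrix S S ℝ) (x y : S),
      P ∈ Matrix.rowStochastic ℝ S ∧ CanBeCoupledToMeet P x y ∧ ∀ l, HasTVLimit P x y l →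
        (z : ℝ) / H - bitProb (L + m + 1) (fun c => |walk H z c m| < H) - (4 * m + 2) / L ≤ l := by
  have hL0 : 0 < L := by omega
  have hH0 : 0 < H := (abs_nonneg z).trans_lt hzH
  have : Nonempty (Fin L) := ⟨⟨0, hL0⟩⟩
  obtain ⟨Φ, hΦ, hm⟩ := exists_noise_coupling hL hzH π hπ hmeet
  obtain ⟨S, h1, h2, P, x, y, hP, hc, hl⟩ := exists_chain_of_noiseTraj_meet (L + m + 1) _
    (finite_bounded H L) (delayedStep H (2 * m + 2) (L - m))
    (fun t q hq a => bounded_delayedStep hq a)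
    (x := wait z 0) (y := wait (-z) 0) ⟨hzH.le, hL0⟩ ⟨by rw [abs_neg]; exact hzH.le, hL0⟩ Φ hΦ hm
  refine ⟨S, h1, h2, P, x, y, hP, hc, fun l hlim => le_trans ?_ (hl l hlim (pos H))⟩
  set α := bitProb (L + m + 1) (fun c => |walk H z c m| < H) with hα
  have hX : uprob (fun g : Fin L => 2 * m ≤ (g : ℕ) ∧ (g : ℕ) + 2 + m < L - m) *
      bitProb (L + m + 1) (fun c => walk H z c m = H) ≤
      uprob (fun ω : Fin (L + m + 1) → Fin L × Bool =>
        noiseTraj (delayedStep H (2 * m + 2) (L - m)) (wait z 0) ω (L + m + 1) = pos H) := by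
    rw [← uprob_delay_walkBits hL0 (fun g => 2 * m ≤ g ∧ g + 2 + m < L - m)]
    refine uprob_mono fun ω ⟨⟨hg1, hg2⟩, hw⟩ => ?_
    rw [delayedTraj_final ω (by rw [hw]; exact le_abs_self _),
      delayedTraj_kept ω le_rfl (by omega) hg2, hw]
  have hY : uprob (fun ω : Fin (L + m + 1) → Fin L × Bool =>
      noiseTraj (delayedStep H (2 * m + 2) (L - m)) (wait (-z) 0) ω (L + m + 1) = pos H) ≤
        bitProb (L + m + 1) (fun c => walk H (-z) c (L + m + 1) = H) := by
    rw [← one_mul (bitProb _ _), ← uprob_eq_one (p := fun _ : Fin L => True) (by simp),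
      ← uprob_delay_walkBits hL0 (fun _ => True)]
    refine uprob_mono fun ω hω => ⟨trivial, ?_⟩
    have hg := delay_lt ω
    have h := delayedTraj_eq_or (H := H) (z := -z) (lo := 2 * m + 2) (hi := L - m) ω
      (n := L + m + 1 - (delay ω + 2)) (by omega)
    rw [show delay ω + 2 + (L + m + 1 - (delay ω + 2)) = L + m + 1 by omega, hω] at h
    have hw : walk H (-z) (extendBits (walkBits ω)) (L + m + 1 - (delay ω + 2)) = H := by
      rcases h with h | h
      · exact (DelayedState.pos.inj h).symm
      · exact absurd h (by simp)
    rw [walk_of_absorbed (by rw [hw]; exact le_abs_self _) (Nat.sub_le _ _), hw]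
  have hgood : 1 - (4 * m + 2 : ℝ) / L ≤
      uprob (fun g : Fin L => 2 * m ≤ (g : ℕ) ∧ (g : ℕ) + 2 + m < L - m) := by
    have hLR : (0 : ℝ) < L := by exact_mod_cast hL0
    have hcard : L - (4 * m + 2) ≤
        Nat.card {g : Fin L // 2 * m ≤ (g : ℕ) ∧ (g : ℕ) + 2 + m < L - m} := by
      rw [← Nat.card_fin (L - (4 * m + 2))]
      refine Nat.card_le_card_of_injective (fun i => ⟨⟨2 * m + i, by omega⟩, by
        simp only
        omega⟩) fun i j hij => ?_
      have := congrArg (fun g => (g.1 : ℕ)) hij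
      simp only at this
      exact Fin.ext (by omega)
    rw [uprob, Nat.card_fin, one_sub_div hLR.ne', div_le_div_iff_of_pos_right hLR]
    have h : L ≤ Nat.card {g : Fin L // 2 * m ≤ (g : ℕ) ∧ (g : ℕ) + 2 + m < L - m} +
      (4 * m + 2) := by omega
    have h' := (Nat.cast_le (α := ℝ)).2 h
    push_cast at h'
    linarith
  have hHR : (0 : ℝ) < H := by exact_mod_cast hH0
  have e1 := le_bitProb_top hzH.le hH0 (m := m) (T := L + m + 1) (by omega)
  have e2 := bitProb_top_le (z := -z) (by rw [abs_neg]; exact hzH.le) hH0 (n := L + m + 1)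
    (T := L + m + 1) le_rfl
  set a := bitProb (L + m + 1) (fun c => walk H z c m = H) with ha
  set b := bitProb (L + m + 1) (fun c => walk H (-z) c (L + m + 1) = H) with hb
  have ha0 : 0 ≤ a := bitProb_nonneg _
  have ha1 : a ≤ 1 := bitProb_le_one _
  have e3 : (z : ℝ) / H ≤ a + α - b := by
    rw [div_le_iff₀ hHR]
    push_cast at e2
    nlinarith
  have hr : (0 : ℝ) ≤ (4 * m + 2) / L := by positivity
  have e4 : a - (4 * m + 2 : ℝ) / L ≤
      uprob (fun g : Fin L => 2 * m ≤ (g : ℕ) ∧ (g : ℕ) + 2 + m < L - m) * a := by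
    have := mul_le_mul_of_nonneg_right hgood ha0
    nlinarith
  linarith

end DelayedWalk

/-! ### The supremum -/

lemma segregationLimits_subset : segregationLimits ⊆ meetingLimits := by
  rintro l ⟨S, h1, h2, P, x, y, hP, hs, hl⟩
  exact ⟨S, h1, h2, P, x, y, hP, hs.1, hl⟩

lemma half_mem_upperBounds_meetingLimits : 1 / 2 ∈ upperBounds meetingLimits := by
  rintro l ⟨S, h1, h2, P, x, y, hP, hc, hl⟩
  exact tvLimit_le_half_of_meet hP hc hl

/-- The delayed walk on `[-2k, 2k]` from `±(k - 1)`: at `±k` the maximal inequalities would be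
tight, and the discrete path coupling needs a little room. -/
theorem exists_meetingLimit_ge (k : ℕ) (hk : 2 ≤ k) :
    ∃ (S : Type) (_ : Fintype S) (_ : DecidableEq S) (P : Matrix S S ℝ) (x y : S),
      P ∈ Matrix.rowStochastic ℝ S ∧ CanBeCoupledToMeet P x y ∧
        ∀ l, HasTVLimit P x y l → 1 / 2 - 2 / (k : ℝ) ≤ l := by
  obtain ⟨m, hm, hpos⟩ := exists_posProb_le_aliveProb (H := 2 * k) (by omega) (8 * k ^ 3)
  have hkR : (2 : ℝ) ≤ k := by exact_mod_cast hk
  have hk0 : (0 : ℝ) < k := by linarith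
  -- extreme delays then have probability `1 / k`
  set L := k * (4 * m + 2) with hLdef
  have hL : m < L := by nlinarith
  have hz : ((k : ℤ) - 1 : ℤ) < 2 * k := by omega
  have habs : |(k : ℤ) - 1| < 2 * k := by rw [abs_lt]; omega
  have hα : bitProb (L + m + 1) (fun c => |walk (2 * k) ((k : ℤ) - 1) c m| < 2 * k) ≤
      1 / (2 * k) := by
    have h := mul_bitProb_alive_le (H := 2 * k) m (L + m + 1) (by omega) ((k : ℤ) - 1) habs.le
    have hmR : (8 * (k : ℝ) ^ 3) ≤ m := by exact_mod_cast hm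
    have h0 := bitProb_nonneg (T := L + m + 1)
      (fun c => |walk (2 * k) ((k : ℤ) - 1) c m| < 2 * k)
    have h1 := mul_le_mul_of_nonneg_right hmR h0
    push_cast at h
    rw [le_div_iff₀ (by positivity)]
    have hk2 : 0 < (k : ℝ) ^ 2 := by positivity
    have h2 : 4 * (k : ℝ) ^ 2 * (bitProb (L + m + 1)
        (fun c => |walk (2 * k) ((k : ℤ) - 1) c m| < 2 * k) * (2 * k)) ≤ 4 * (k : ℝ) ^ 2 * 1 := by
      linarith
    exact le_of_mul_le_mul_left h2 (by positivity)
  have hnum : ∀ j : ℤ, 1 ≤ j → j ≤ (k : ℤ) - 1 →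
      ((((k : ℤ) - 1 : ℤ) : ℝ) - j + 1) / (((2 * k : ℤ) : ℝ) - j + 1) +
        ((((k : ℤ) - 1 : ℤ) : ℝ) + j) / (((2 * k : ℤ) : ℝ) + j) ≤ 1 - 1 / (2 * (k : ℝ)) := by
    intro j hj hjk
    have hjR : (1 : ℝ) ≤ j := by exact_mod_cast hj
    have hjkR : (j : ℝ) ≤ k - 1 := by exact_mod_cast hjk
    push_cast
    rw [div_add_div _ _ (by linarith) (by linarith), one_sub_div (by positivity),
      div_le_div_iff₀ (by nlinarith) (by positivity)]
    nlinarith [mul_nonneg (sub_nonneg.2 hjR) (by linarith : (0 : ℝ) ≤ j)]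
  obtain ⟨π, hπ, hmeet⟩ := exists_path_coupling (T := L + m + 1) (by omega)
    (by omega : (0 : ℤ) < (k : ℤ) - 1) hz hα hnum fun v h1 h2 => hpos _ v (by omega) hz h1 h2
  obtain ⟨S, h1, h2, P, x, y, hP, hc, hl⟩ := exists_chain_of_path_coupling hL habs π hπ hmeet
  refine ⟨S, h1, h2, P, x, y, hP, hc, fun l hlim => le_trans ?_ (hl l hlim)⟩
  have e1 : (((k : ℤ) - 1 : ℤ) : ℝ) / ((2 * k : ℤ) : ℝ) = 1 / 2 - 1 / (2 * k) := by
    push_cast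
    field_simp
  have e2 : (4 * m + 2 : ℝ) / (L : ℝ) = 1 / k := by
    rw [hLdef]
    push_cast
    field_simp
  rw [e1, e2]
  have e3 : 2 / (k : ℝ) = 1 / (2 * k) + 1 / (2 * k) + 1 / k := by
    field_simp
    norm_num
  linarith

lemma exists_mem_segregationLimits_gt {b : ℝ} (hb : b < 1 / 2) :
    ∃ l ∈ segregationLimits, b < l := by
  obtain ⟨k, hk⟩ := exists_nat_gt (max 4 (2 / (1 / 2 - b)))
  have hk4 : (4 : ℝ) < k := (le_max_left _ _).trans_lt hk
  have hkb : 2 / (1 / 2 - b) < k := (le_max_right _ _).trans_lt hk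
  have hk2 : 2 ≤ k := by
    have : (4 : ℕ) < k := by exact_mod_cast hk4
    omega
  obtain ⟨S, h1, h2, P, x, y, hP, hc, hl⟩ := exists_meetingLimit_ge k hk2
  obtain ⟨l, hlim⟩ := exists_hasTVLimit hP x y
  have hle := hl l hlim
  have hk0 : (0 : ℝ) < k := by linarith
  have h3 : 2 / (k : ℝ) < 1 / 2 := by
    rw [div_lt_iff₀ hk0]; linarith
  have h4 : 2 / (k : ℝ) < 1 / 2 - b := by
    rw [div_lt_iff₀ (by linarith)] at hkb
    rw [div_lt_iff₀ hk0]
    linarith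
  exact ⟨l, ⟨S, h1, h2, P, x, y, hP, ⟨hc, l, by linarith, hlim⟩, hlim⟩, by linarith⟩

theorem mainTheorem1 :
    (∀ (S : Type) [Fintype S] [DecidableEq S] (P : Matrix S S ℝ) (x y : S),
      P ∈ Matrix.rowStochastic ℝ S → ∃ l : ℝ, HasTVLimit P x y l) ∧
    IsLUB meetingLimits kappa ∧
    kappa = 1 / 2 ∧
    IsLUB segregationLimits (1 / 2) := by
  have hmeet : IsLUB meetingLimits (1 / 2) := by
    refine ⟨half_mem_upperBounds_meetingLimits, fun b hb => ?_⟩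
    by_contra! h
    obtain ⟨l, hl, hlt⟩ := exists_mem_segregationLimits_gt h
    exact absurd (hb (segregationLimits_subset hl)) (not_le.2 hlt)
  have hseg : IsLUB segregationLimits (1 / 2) := by
    refine ⟨fun l hl => half_mem_upperBounds_meetingLimits (segregationLimits_subset hl),
      fun b hb => ?_⟩
    by_contra! h
    obtain ⟨l, hl, hlt⟩ := exists_mem_segregationLimits_gt h
    exact absurd (hb hl) (not_le.2 hlt)
  have hne : meetingLimits.Nonempty := by
    obtain ⟨l, hl, -⟩ := exists_mem_segregationLimits_gt (b := 0) (by norm_num)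
    exact ⟨l, segregationLimits_subset hl⟩
  have hkappa : kappa = 1 / 2 := hmeet.csSup_eq hne
  exact ⟨fun S _ _ P x y hP => exists_hasTVLimit hP x y, hkappa ▸ hmeet, hkappa, hseg⟩
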